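/- For $m\ge 0$ write $[m]=\{1,\dots,m\}$. Let $n,t\ge 0$ be integers, and let $\mathcal O=\{\mathcal O_1,\dots,\mathcal O_u\}$ and $\mathcal E=\{\mathcal E_1,\dots,\mathcal E_v\}$ ($u,v\ge 0$) be families of subsets of $[t]$ such that all the sets $\mathcal O_1,\dots,\mathcal O_u,\mathcal E_1,\dots,\mathcal E_v$ are pairwise disjoint and $|\mathcal E_j|\ge 2$ for every $j$. Let $\Delta_n(\mathcal O,\mathcal E,t)$ be the following chain complex of free abelian groups. It has as a basis the pairs $(\pi,f)$, where $\pi=(\pi_1,\dots,\pi_m)$ is a sequence of positive integers and $f:[t]\to[m]$ is a map, such that 1. $t\le\sum_{i=1}^m\pi_i\le n$; 2. $|f^{-1}(j)|\le\pi_j$ for all $j\in[m]$; 3. for all $x<y$ in $[t]$: if $x,y\in\mathcal O_i$ for some $i$, then $f(x)<f(y)$; if $x,y\in\mathcal E_i$ for some $i$, then $f(x)\le f(y)$. The pair $(\pi,f)$ with $\pi=(\pi_1,\dots,\pi_m)$ has degree $m-1$. (The value $m=0$ is allowed; it occurs only for $t=0$, where the empty sequence, in degree $-1$, is the usual augmentation.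 So for $t=0$ the homology below is reduced homology.) The boundary is $$\partial(\pi,f)=\sum_{i=1}^{m-1}(-1)^i(\pi^i,f^i)+(-1)^m\epsilon$$ for $m\ge 1$, and $0$ for $m=0$. Here $\pi^i=(\pi_1,\dots,\pi_{i-1},\pi_i+\pi_{i+1},\pi_{i+2},\dots,\pi_m)$; $f^i(x)=f(x)$ if $f(x)\le i$ and $f^i(x)=f(x)-1$ if $f(x)\ge i+1$; a term $(\pi^i,f^i)$ that violates condition 3 is read as $0$; $\epsilon=((\pi_1,\dots,\pi_{m-1}),f)$ if $m\notin\operatorname{im} f$, and $\epsilon=0$ if $m\in\operatorname{im} f$. Then $\Delta_n(\mathcal O,\mathcal E,t)$ is acyclic (all its homology groups vanish) unless $t=n$ and $v=0$, i.e. $\mathcal E=\emptyset$. In that case it has the reduced homology of an $(n-1)$-sphere: $$H_i(\Delta_n(\mathcal O,\emptyset,n))\cong\begin{cases}\mathbb Z,&i=n-1,\\0,&\text{otherwise.}\end{cases}$$ -/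

import Mathlib

open CategoryTheory

/-- A sequence `size = (π₁, …, π_m)` together with a map `pos : [t] → [m]`; indices start at `0`. -/
@[ext]
structure BlockPair (t m : ℕ) where
  size : Fin m → ℕ
  pos : Fin t → Fin m

namespace BlockPair

variable {t m n u v : ℕ}

/-- The pairs `(π, f)` that index the basis of `Δ_n(O, E, t)`. -/
structure IsBasic (n : ℕ) (O : Fin u → Finset (Fin t)) (E : Fin v → Finset (Fin t))
    (p : BlockPair t m) : Prop where
  size_pos : ∀ j, 1 ≤ p.size j
  le_sum : t ≤ ∑ j, p.size j
  sum_le : ∑ j, p.size j ≤ n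
  card_le : ∀ j, (Finset.univ.filter fun x => p.pos x = j).card ≤ p.size j
  strict : ∀ i, ∀ x ∈ O i, ∀ y ∈ O i, x < y → p.pos x < p.pos y
  weak : ∀ i, ∀ x ∈ E i, ∀ y ∈ E i, x < y → p.pos x ≤ p.pos y

/-- `(πⁱ, fⁱ)`: the blocks `i` and `i + 1` are merged. -/
def merge (i : Fin m) (p : BlockPair t (m + 1)) : BlockPair t m where
  size j :=
    if j < i then p.size j.castSucc
    else if j = i then p.size i.castSucc + p.size i.succ
    else p.size j.succ
  pos x := i.predAbove (p.pos x)

/-- `(π', f')`: the last block is removed, which is possible if no element lies in it. -/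
def dropLast (p : BlockPair t (m + 1)) (h : ∀ x, p.pos x ≠ Fin.last m) : BlockPair t m where
  size j := p.size j.castSucc
  pos x := (p.pos x).castPred (h x)

end BlockPair

/-- The basis elements of `Δ_n(O, E, t)` with `m` blocks. -/
abbrev DeltaCell {t u v : ℕ} (n : ℕ) (O : Fin u → Finset (Fin t)) (E : Fin v → Finset (Fin t))
    (m : ℕ) : Type :=
  {p : BlockPair t m // p.IsBasic n O E}

namespace DeltaCell

variable {t u v : ℕ} (n : ℕ) (O : Fin u → Finset (Fin t)) (E : Fin v → Finset (Fin t))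

open Classical in
/-- A pair `(π, f)` as a chain; a pair that does not index a basis element is `0`. -/
noncomputable def chain {m : ℕ} (p : BlockPair t m) : DeltaCell n O E m →₀ ℤ :=
  if h : p.IsBasic n O E then Finsupp.single ⟨p, h⟩ 1 else 0

open Classical in
/-- The term `ε` of the boundary. -/
noncomputable def lastTerm {m : ℕ} (p : BlockPair t (m + 1)) : DeltaCell n O E m →₀ ℤ :=
  if h : ∀ x, p.pos x ≠ Fin.last m then chain n O E (p.dropLast h) else 0

/-- The boundary of `(π, f)` with `π = (π₁, …, π_{m+1})`, that is
`∑_{i=1}^{m} (-1)^i (πⁱ, fⁱ) + (-1)^{m+1} ε`. -/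
noncomputable def bdry {m : ℕ} (p : BlockPair t (m + 1)) : DeltaCell n O E m →₀ ℤ :=
  ∑ i : Fin m, (-1 : ℤ) ^ ((i : ℕ) + 1) • chain n O E (p.merge i)
    + (-1 : ℤ) ^ (m + 1) • lastTerm n O E p

/-- The boundary map, extended linearly from the basis. -/
noncomputable def bdryMap (m : ℕ) :
    (DeltaCell n O E (m + 1) →₀ ℤ) →ₗ[ℤ] (DeltaCell n O E m →₀ ℤ) :=
  Finsupp.linearCombination ℤ fun c : DeltaCell n O E (m + 1) => bdry n O E c.1

/-! Proof that the boundary map squares to zero. -/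

open Classical in
/-- All faces at once, `none` being the vanishing last face. -/
noncomputable def face {m : ℕ} (i : Fin (m + 1)) (p : BlockPair t (m + 1)) :
    Option (BlockPair t m) :=
  if hi : (i : ℕ) < m then some (p.merge ⟨i, hi⟩)
  else if h : ∀ x, p.pos x ≠ Fin.last m then some (p.dropLast h) else none

/-- The chain of a face. -/
noncomputable def optChain {m : ℕ} (o : Option (BlockPair t m)) : DeltaCell n O E m →₀ ℤ :=
  o.elim 0 (chain n O E)

/-- A face map on chains. -/
noncomputable def faceMap {m : ℕ} (i : Fin (m + 1)) :
    (DeltaCell n O E (m + 1) →₀ ℤ) →ₗ[ℤ] (DeltaCell n O E m →₀ ℤ) :=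
  Finsupp.linearCombination ℤ fun c : DeltaCell n O E (m + 1) => optChain n O E (face i c.1)

lemma bdryMap_eq (m : ℕ) :
    bdryMap n O E m = ∑ i : Fin (m + 1), (-1 : ℤ) ^ ((i : ℕ) + 1) • faceMap n O E i := by
  apply Finsupp.lhom_ext'
  intro c
  ext1
  simp [bdryMap, faceMap, Fin.sum_univ_castSucc, bdry, face, optChain, lastTerm]
  split_ifs <;> simp

lemma val_castPred' {m : ℕ} (k : Fin (m + 1)) (h : k ≠ Fin.last m) :
    ((k.castPred h : Fin m) : ℕ) = k := rfl

lemma val_predAbove {m : ℕ} (i : Fin m) (k : Fin (m + 1)) :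
    ((i.predAbove k : Fin m) : ℕ) = if (i : ℕ) < k then (k : ℕ) - 1 else k := by
  unfold Fin.predAbove
  simp only [Fin.lt_def, Fin.val_castSucc]
  split_ifs <;> simp

lemma merge_merge {m : ℕ} (i j : Fin m) (hij : i ≤ j) (p : BlockPair t (m + 2)) :
    (p.merge j.succ).merge i = (p.merge i.castSucc).merge j := by
  have hij' : (i : ℕ) ≤ j := hij
  ext k
  · simp only [BlockPair.merge, Fin.lt_def, Fin.ext_iff, Fin.val_castSucc, Fin.val_succ]
    have e : ∀ a b : Fin (m + 2), (a : ℕ) = b → p.size a = p.size b :=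
      fun a b h => congrArg _ (Fin.ext h)
    split_ifs <;> first
      | omega
      | rfl
      | (rw [← Nat.add_assoc (p.size _)]; congr 2; apply e; simp; omega)
  · simp only [BlockPair.merge, val_predAbove, Fin.val_castSucc, Fin.val_succ]
    split_ifs <;> omega

lemma face_castSucc {m : ℕ} (i : Fin m) (p : BlockPair t (m + 1)) :
    face i.castSucc p = some (p.merge i) := by
  simp [face]

open Classical in
lemma face_last {m : ℕ} (p : BlockPair t (m + 1)) :
    face (Fin.last m) p =
      if h : ∀ x, p.pos x ≠ Fin.last m then some (p.dropLast h) else none := by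
  simp [face]

lemma face_face {m : ℕ} (i j : Fin (m + 1)) (hij : i ≤ j) (p : BlockPair t (m + 2)) :
    (face j.succ p).bind (face i) = (face i.castSucc p).bind (face j) := by
  rw [face_castSucc, Option.bind_some]
  induction j using Fin.lastCases with
  | cast j =>
    have hi : (i : ℕ) < m := lt_of_le_of_lt (Fin.le_def.1 hij) j.2
    obtain ⟨i, rfl⟩ : ∃ i' : Fin m, i = i'.castSucc := ⟨⟨i, hi⟩, rfl⟩
    rw [Fin.succ_castSucc, face_castSucc, Option.bind_some, face_castSucc, face_castSucc,
      merge_merge i j (by simpa using hij)]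
  | last =>
    rw [Fin.succ_last, face_last, face_last]
    induction i using Fin.lastCases with
    | cast i =>
      have hiff : (∀ x, (p.merge i.castSucc).pos x ≠ Fin.last m) ↔
          ∀ x, p.pos x ≠ Fin.last (m + 1) := by
        refine forall_congr' fun x => not_congr ?_
        have := (p.pos x).2
        have := i.2
        simp only [BlockPair.merge, Fin.ext_iff, val_predAbove, Fin.val_last, Fin.val_castSucc]
        split_ifs <;> omega
      by_cases h : ∀ x, p.pos x ≠ Fin.last (m + 1)
      · rw [dif_pos h, dif_pos (hiff.2 h), Option.bind_some, face_castSucc]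
        congr 1
        ext k
        · simp only [BlockPair.merge, BlockPair.dropLast, Fin.lt_def, Fin.ext_iff,
            Fin.val_castSucc]
          rfl
        · simp only [BlockPair.merge, BlockPair.dropLast, val_predAbove, val_castPred',
            Fin.val_castSucc]
          rfl
      · rw [dif_neg h, dif_neg (hiff.not.2 h)]
        rfl
    | last =>
      have hiff : (∀ x, (p.merge (Fin.last m)).pos x ≠ Fin.last m) ↔
          ∀ x, (p.pos x : ℕ) < m := by
        refine forall_congr' fun x => ?_
        have := (p.pos x).2
        simp only [BlockPair.merge, ne_eq, Fin.ext_iff, val_predAbove, Fin.val_last]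
        split_ifs <;> omega
      by_cases h : ∀ x, (p.pos x : ℕ) < m
      · have h1 : ∀ x, p.pos x ≠ Fin.last (m + 1) := by
          intro x hx
          have := h x
          rw [hx, Fin.val_last] at this
          omega
        have h2 : ∀ x, (p.dropLast h1).pos x ≠ Fin.last m := by
          intro x hx
          have := h x
          simp only [BlockPair.dropLast, Fin.ext_iff, val_castPred', Fin.val_last] at hx
          omega
        rw [dif_pos h1, dif_pos (hiff.2 h), Option.bind_some, face_last, dif_pos h2]
        congr 1
        ext k
        · simp [BlockPair.merge, BlockPair.dropLast, Fin.lt_def]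
        · have := h k
          simp only [BlockPair.merge, BlockPair.dropLast, val_predAbove, val_castPred',
            Fin.val_last]
          split_ifs <;> omega
      · rw [dif_neg (hiff.not.2 h)]
        by_cases h1 : ∀ x, p.pos x ≠ Fin.last (m + 1)
        · rw [dif_pos h1, Option.bind_some, face_last, dif_neg]
          intro h2
          apply h
          intro x
          have h3 := h1 x
          have h4 := h2 x
          have := (p.pos x).2
          simp only [BlockPair.dropLast, ne_eq, Fin.ext_iff, val_castPred', Fin.val_last]
            at h3 h4
          omega
        · rw [dif_neg h1]
          rfl

lemma face_pos {m : ℕ} {k : Fin (m + 1)} {p : BlockPair t (m + 1)} {q : BlockPair t m}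
    (hq : face k p = some q) (x : Fin t) :
    (q.pos x : ℕ) = if (k : ℕ) < p.pos x then (p.pos x : ℕ) - 1 else p.pos x := by
  induction k using Fin.lastCases with
  | cast k =>
    rw [face_castSucc, Option.some_inj] at hq
    subst hq
    simp [BlockPair.merge, val_predAbove]
  | last =>
    rw [face_last] at hq
    split_ifs at hq with h
    rw [Option.some_inj] at hq
    subst hq
    have := (p.pos x).2
    simp only [BlockPair.dropLast, val_castPred', Fin.val_last]
    split_ifs <;> omega

lemma merge_size {m : ℕ} (i : Fin m) (p : BlockPair t (m + 1)) (j : Fin m) :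
    (p.merge i).size j = ∑ k with i.predAbove k = j, p.size k := by
  have hl : ∀ l : Fin m, i.predAbove (i.castSucc.succAbove l) = l := by
    intro l
    rw [Fin.ext_iff, val_predAbove]
    unfold Fin.succAbove
    simp only [Fin.lt_def, Fin.val_castSucc]
    split_ifs with h1 h2 h2 <;> simp at h2 ⊢ <;> omega
  rw [Finset.sum_filter, Fin.sum_univ_succAbove _ i.castSucc]
  simp only [hl, Finset.sum_ite_eq', Finset.mem_univ, if_true, Fin.predAbove_castSucc_self]
  unfold Fin.succAbove
  simp only [BlockPair.merge, Fin.lt_def, Fin.ext_iff, Fin.val_castSucc]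
  split_ifs with h1 h2 h2 h2
  · omega
  · omega
  · have : j = i := Fin.ext (by omega)
    rw [this]
  · omega
  · omega
  · simp

lemma face_sum {m : ℕ} {k : Fin (m + 1)} {p : BlockPair t (m + 1)} {q : BlockPair t m}
    (hq : face k p = some q) : ∑ j, q.size j ≤ ∑ j, p.size j := by
  induction k using Fin.lastCases with
  | cast k =>
    rw [face_castSucc, Option.some_inj] at hq
    subst hq
    simp only [merge_size]
    rw [Finset.sum_fiberwise]
  | last =>
    rw [face_last] at hq
    split_ifs at hq with h
    rw [Option.some_inj] at hq
    subst hq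
    rw [Fin.sum_univ_castSucc (f := p.size)]
    exact Nat.le_add_right _ _

lemma face_size_pos {m : ℕ} {k : Fin (m + 1)} {p : BlockPair t (m + 1)} {q : BlockPair t m}
    (hq : face k p = some q) (hp : ∀ j, 1 ≤ p.size j) (j : Fin m) : 1 ≤ q.size j := by
  induction k using Fin.lastCases with
  | cast k =>
    rw [face_castSucc, Option.some_inj] at hq
    subst hq
    simp only [BlockPair.merge]
    split_ifs
    · exact hp _
    · exact (hp _).trans (Nat.le_add_right _ _)
    · exact hp _
  | last =>
    rw [face_last] at hq
    split_ifs at hq with h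
    rw [Option.some_inj] at hq
    subst hq
    exact hp _

lemma face_card {m : ℕ} {k : Fin (m + 1)} {p : BlockPair t (m + 1)} {q : BlockPair t m}
    (hq : face k p = some q)
    (hp : ∀ j, (Finset.univ.filter fun x => p.pos x = j).card ≤ p.size j) (j : Fin m) :
    (Finset.univ.filter fun x => q.pos x = j).card ≤ q.size j := by
  induction k using Fin.lastCases with
  | cast k =>
    rw [face_castSucc, Option.some_inj] at hq
    subst hq
    rw [merge_size, Finset.card_eq_sum_card_fiberwise (f := p.pos)
      (t := Finset.univ.filter fun l => k.predAbove l = j)]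
    · refine Finset.sum_le_sum fun l _ => le_trans (Finset.card_le_card ?_) (hp l)
      intro x
      simp
    · intro x hx
      have hx' : k.predAbove (p.pos x) = j :=
        (Finset.mem_filter.1 (Finset.mem_coe.1 hx)).2
      simpa using hx'
  | last =>
    rw [face_last] at hq
    split_ifs at hq with h
    rw [Option.some_inj] at hq
    subst hq
    refine le_trans (Finset.card_le_card ?_) (hp j.castSucc)
    intro x
    simp only [Finset.mem_filter, Finset.mem_univ, true_and]
    intro hx
    rw [← hx]
    rfl

lemma le_sum_of_card {m : ℕ} {q : BlockPair t m}
    (hq : ∀ j, (Finset.univ.filter fun x => q.pos x = j).card ≤ q.size j) :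
    t ≤ ∑ j, q.size j := by
  calc t = (Finset.univ : Finset (Fin t)).card := by simp
    _ = ∑ j, (Finset.univ.filter fun x => q.pos x = j).card :=
      Finset.card_eq_sum_card_fiberwise fun x _ => by simp
    _ ≤ _ := Finset.sum_le_sum fun j _ => hq j

variable {n O E}

lemma basic_of_face {m : ℕ} (j : Fin (m + 1)) (k : Fin (m + 2)) (p : BlockPair t (m + 2))
    (hp : p.IsBasic n O E) (q : BlockPair t (m + 1)) (hq : face k p = some q)
    (r : BlockPair t m) (hr : face j q = some r) (h : r.IsBasic n O E) : q.IsBasic n O E := by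
  have hc := face_card hq hp.card_le
  refine ⟨face_size_pos hq hp.size_pos, le_sum_of_card hc, (face_sum hq).trans hp.sum_le, hc, ?_, ?_⟩
  · intro i x hx y hy hxy
    have := h.strict i x hx y hy hxy
    rw [Fin.lt_def, face_pos hr, face_pos hr] at this
    rw [Fin.lt_def]
    split_ifs at this <;> omega
  · intro i x hx y hy hxy
    have := hp.weak i x hx y hy hxy
    rw [Fin.le_def] at this ⊢
    rw [face_pos hq, face_pos hq]
    split_ifs <;> omega

variable (n O E)

lemma faceMap_comp {m : ℕ} (i : Fin (m + 1)) (k : Fin (m + 2)) (c : DeltaCell n O E (m + 2)) :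
    faceMap n O E i (faceMap n O E k (Finsupp.single c 1))
      = optChain n O E ((face k c.1).bind (face i)) := by
  simp only [faceMap, Finsupp.linearCombination_single, one_smul]
  rcases hq : face k c.1 with _ | q
  · simp [optChain]
  · simp only [optChain, Option.elim_some, Option.bind_some]
    by_cases h : q.IsBasic n O E
    · simp [chain, h]
    · rw [chain, dif_neg h, map_zero]
      rcases hr : face i q with _ | r
      · rfl
      · rw [Option.elim_some, chain, dif_neg]
        exact fun hb => h (basic_of_face i k c.1 c.2 q hq r hr hb)

lemma alternating_sum_eq_zero {M : Type*} [AddCommGroup M] {m : ℕ}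
    (A : Fin (m + 1) → Fin (m + 2) → M)
    (hA : ∀ i j : Fin (m + 1), i ≤ j → A i j.succ = A j i.castSucc) :
    ∑ k : Fin (m + 2), ∑ i : Fin (m + 1),
      ((-1 : ℤ) ^ ((k : ℕ) + 1) * (-1 : ℤ) ^ ((i : ℕ) + 1)) • A i k = 0 := by
  rw [Finset.sum_comm, ← Finset.sum_product', Finset.univ_product_univ]
  let P := Fin (m + 1) × Fin (m + 2)
  let S : Finset P := {ij : P | (ij.2 : ℕ) ≤ (ij.1 : ℕ)}
  rw [← Finset.sum_add_sum_compl S, ← eq_neg_iff_add_eq_zero, ← Finset.sum_neg_distrib]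
  let φ : ∀ ij : P, ij ∈ S → P := fun ij hij =>
    (Fin.castLT ij.2 (lt_of_le_of_lt (Finset.mem_filter.mp hij).right (Fin.is_lt ij.1)), ij.1.succ)
  apply Finset.sum_bij φ
  · intro ij hij
    simp_rw [S, φ, Finset.compl_filter, Finset.mem_filter_univ, Fin.val_succ,
      Fin.val_castLT] at hij ⊢
    lia
  · rintro ⟨i, j⟩ hij ⟨i', j'⟩ hij' h
    have ha := congrArg (fun q : P => (q.1 : ℕ)) h
    have hb := congrArg (fun q : P => (q.2 : ℕ)) h
    simp only [φ, Fin.val_castLT, Fin.val_succ] at ha hb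
    rw [Prod.mk_inj, Fin.ext_iff, Fin.ext_iff]
    omega
  · rintro ⟨i', j'⟩ hij'
    simp_rw [S, Finset.compl_filter, Finset.mem_filter_univ, not_le] at hij'
    refine ⟨(j'.pred ?_, Fin.castSucc i'), ?_, ?_⟩
    · rintro rfl
      simp only [Fin.val_zero, not_lt_zero] at hij'
    · simpa [S] using Nat.le_sub_one_of_lt hij'
    · simp only [φ, Fin.castLT_castSucc, Fin.succ_pred]
  · rintro ⟨i, j⟩ hij
    have hle : (j : ℕ) ≤ i := (Finset.mem_filter.mp hij).right
    have h1 := hA (j.castLT (lt_of_le_of_lt hle i.2)) i hle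
    rw [Fin.castSucc_castLT] at h1
    simp only [φ, h1, Fin.val_succ, Fin.val_castLT, ← neg_smul]
    congr 1
    ring

lemma bdryMap_comp (m : ℕ) : bdryMap n O E m ∘ₗ bdryMap n O E (m + 1) = 0 := by
  apply Finsupp.lhom_ext'
  intro c
  ext1
  have hf : ∀ (i j : Fin (m + 1)), i ≤ j →
      faceMap n O E i (faceMap n O E j.succ (Finsupp.single c 1)) =
        faceMap n O E j (faceMap n O E i.castSucc (Finsupp.single c 1)) := by
    intro i j hij
    rw [faceMap_comp, faceMap_comp, face_face i j hij]
  simp only [bdryMap_eq, LinearMap.comp_apply, LinearMap.sum_apply, LinearMap.smul_apply,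
    Finsupp.lsingle_apply, map_sum, map_smul, LinearMap.zero_apply, Finset.smul_sum, smul_smul]
  exact alternating_sum_eq_zero
    (fun i k => faceMap n O E i (faceMap n O E k (Finsupp.single c 1))) hf

end DeltaCell

/-- The complex `Δ_n(O, E, t)`, indexed by the number `m` of blocks. -/
noncomputable def deltaByBlocks {t u v : ℕ} (n : ℕ) (O : Fin u → Finset (Fin t))
    (E : Fin v → Finset (Fin t)) : ChainComplex (ModuleCat.{0} ℤ) ℕ :=
  ChainComplex.of (fun m => ModuleCat.of ℤ (DeltaCell n O E m →₀ ℤ))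
    (fun m => ModuleCat.ofHom (DeltaCell.bdryMap n O E m))
    (fun m => by
      rw [← ModuleCat.ofHom_comp, DeltaCell.bdryMap_comp]
      rfl)

/-- The shift of indices `m ↦ m - 1`. -/
def blocksToDegree : ComplexShape.Embedding (ComplexShape.down ℕ) (ComplexShape.down ℤ) :=
  ComplexShape.Embedding.mk' _ _ (fun m => (m : ℤ) - 1)
    (fun _ _ h => by simpa using h)
    (by intro a b; simp only [ComplexShape.down_Rel]; lia)

/-- The chain complex `Δ_n(O, E, t)`: a pair `(π, f)` with `π = (π₁, …, π_m)` has degree `m - 1`.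
The value `m = 0` occurs only for `t = 0`; the empty sequence then is the augmentation, so that
the homology is the reduced one. -/
noncomputable def deltaComplex {t u v : ℕ} (n : ℕ) (O : Fin u → Finset (Fin t))
    (E : Fin v → Finset (Fin t)) : ChainComplex (ModuleCat.{0} ℤ) ℤ :=
  (deltaByBlocks n O E).extend blocksToDegree

/-!
The proof is a discrete Morse argument combined with an induction on `t`, which removes the element
`0` of `[t + 1]`. A `CellMatching` pairs cells `a` with cells `split a` of one degree more, so that
the boundary of `split a` consists of `±a`, of lower members of other pairs, all of smaller rank
than `a`, and of upper members; by `CellMatching.exists_bdry_eq` the matched cells span an acyclic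
complex.

* For `t = 0` the complex is the augmented chain complex of the simplex on `n` vertices. For `n > 0`
  a composition of a number less than `n` is matched with its completion to a composition of `n`
  (`exists_bdry_eq_of_zero`). For `n = 0` only the empty sequence is left.
* Suppose that `0` lies in some `E i`. As `0` is the least element of `E i`, splitting it off to the
  left, from a block `{0} ∪ b` to the two blocks `{0}, b`, respects the order conditions. Conversely
  a block `{0}` can always be merged with the next one: this exists since `E i` has another element.
  So all cells are matched and the complex is acyclic (`exists_bdry_eq_of_mem_weak`).
* Suppose that `0` lies in no `E i`. If it lies in some `O i`, it is the least element there, so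
  that it can be split off to the right, from `b ∪ {0}` to `b, {0}`, and a block `{0}` can be merged
  with the previous one. Only the cells with first block `{0}` of size `1` remain unmatched, and the
  matched ones span an acyclic subcomplex (`exists_bdry_eq_of_noncritical`). The quotient by it is,
  up to a shift by one degree and a sign, the complex with `n`, `t` lowered by one and `0` removed
  from the families (`critProj_bdryMap`). So the homology is the shifted one of a smaller complex
  (`exists_bdry_eq_succ`, `exists_generator_succ`).

For `t > n` there are no cells. Let `t ≤ n`. If `E` is nonempty, the second case occurs at some
stage. Otherwise the induction ends with the simplex on `n - t` vertices, which is acyclic unless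
`n = t`; in that case a single generator of degree `-1` is left, and the `n` shifts carry it to
degree `n - 1`. As there are no cells of larger degree, the homology in degree `n - 1` is the group
of cycles.
-/

/-! ### Acyclic matchings -/

/-- Cycles of a sequence of boundary maps; in degree `0` every chain is a cycle. -/
def IsFreeCycle {X : ℕ → Type} (d : ∀ m, (X (m + 1) →₀ ℤ) →ₗ[ℤ] (X m →₀ ℤ)) :
    ∀ {m : ℕ}, (X m →₀ ℤ) → Prop
  | 0, _ => True
  | m + 1, z => d m z = 0

lemma linearMap_apply_eq_sum {X Y : Type} (d : (X →₀ ℤ) →ₗ[ℤ] (Y →₀ ℤ)) (z : X →₀ ℤ) (y : Y) :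
    d z y = ∑ x ∈ z.support, z x * d (Finsupp.single x 1) y := by
  conv_lhs => rw [← Finsupp.sum_single z, Finsupp.sum]
  rw [map_sum, Finsupp.finsetSum_apply]
  refine Finset.sum_congr rfl fun x _ => ?_
  rw [← mul_one (z x), ← smul_eq_mul, ← Finsupp.smul_single, map_smul]
  simp

/-- An acyclic matching: `split` matches the cells of `A` with the cells of `B` one degree higher.
The boundary of `split a` contains `a` with coefficient `±1`, and all its other cells in `A` have
smaller rank; hence `split` is injective. Cells outside `A ∪ B` are critical; the matched cells span
a subcomplex. -/
structure CellMatching {X : ℕ → Type} (d : ∀ m, (X (m + 1) →₀ ℤ) →ₗ[ℤ] (X m →₀ ℤ))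
    (A B : ∀ m, Set (X m)) (split : ∀ m, A m → B (m + 1)) (rank : ∀ m, X m → ℕ) : Prop where
  not_mem_zero : ∀ x, x ∉ B 0
  surjective : ∀ m, Function.Surjective (split m)
  isUnit : ∀ m, ∀ a : A m, IsUnit (d m (Finsupp.single (split m a : X (m + 1)) 1) a)
  rank_lt : ∀ m, ∀ a a' : A m, a' ≠ a →
    d m (Finsupp.single (split m a : X (m + 1)) 1) a' ≠ 0 → rank m a' < rank m a
  closed : ∀ m, ∀ x ∈ A (m + 1) ∪ B (m + 1), ∀ y,
    d m (Finsupp.single x 1) y ≠ 0 → y ∈ A m ∪ B m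

namespace CellMatching

variable {X : ℕ → Type} {d : ∀ m, (X (m + 1) →₀ ℤ) →ₗ[ℤ] (X m →₀ ℤ)}
  {A B : ∀ m, Set (X m)} {split : ∀ m, A m → B (m + 1)} {rank : ∀ m, X m → ℕ}

lemma bdry_mem (M : CellMatching d A B split rank) {m : ℕ} {z : X (m + 1) →₀ ℤ}
    (hz : ∀ x ∈ z.support, x ∈ A (m + 1) ∪ B (m + 1)) :
    ∀ y ∈ (d m z).support, y ∈ A m ∪ B m := by
  intro y hy
  rw [Finsupp.mem_support_iff, linearMap_apply_eq_sum] at hy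
  obtain ⟨x, hx, hxy⟩ := Finset.exists_ne_zero_of_sum_ne_zero hy
  exact M.closed m x (hz x hx) y (right_ne_zero_of_mul hxy)

/-- Modulo boundaries, every chain without critical cells can be pushed into `B`. The cells in `A`
of largest rank are removed first. -/
lemma exists_sub_bdry_mem (M : CellMatching d A B split rank) {m : ℕ} (r : ℕ) :
    ∀ z : X m →₀ ℤ, (∀ x ∈ z.support, x ∈ A m ∪ B m) →
      (∀ x ∈ z.support, x ∈ A m → rank m x < r) →
      ∃ w : X (m + 1) →₀ ℤ, (∀ x ∈ w.support, x ∈ A (m + 1) ∪ B (m + 1)) ∧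
        ∀ x ∈ (z - d m w).support, x ∈ B m := by
  classical
  induction r with
  | zero =>
    intro z hz hr
    refine ⟨0, by simp, ?_⟩
    intro x hx
    rw [map_zero, sub_zero] at hx
    exact (hz x hx).resolve_left fun hA => absurd (hr x hx hA) (Nat.not_lt_zero _)
  | succ r ih =>
    intro z hz hr
    have hs : ∀ x : X m, ∃ σ : X (m + 1) →₀ ℤ, (∀ b ∈ σ.support, b ∈ B (m + 1)) ∧
        (x ∈ A m → d m σ x = 1 ∧ ∀ a ∈ A m, a ≠ x → d m σ a ≠ 0 → rank m a < rank m x) := by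
      intro x
      by_cases hx : x ∈ A m
      · obtain ⟨e, he⟩ := (M.isUnit m ⟨x, hx⟩).exists_right_inv
        refine ⟨e • Finsupp.single (split m ⟨x, hx⟩ : X (m + 1)) 1, ?_, fun _ => ⟨?_, ?_⟩⟩
        · intro b' hb'
          have h := Finsupp.support_single_subset (Finsupp.support_smul hb')
          rw [Finset.mem_singleton.1 h]
          exact (split m ⟨x, hx⟩).2
        · rw [map_smul, Finsupp.smul_apply, smul_eq_mul, mul_comm, he]
        · intro a ha hab hne
          rw [map_smul, Finsupp.smul_apply, smul_eq_mul] at hne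
          exact M.rank_lt m ⟨x, hx⟩ ⟨a, ha⟩ (by simpa using hab) (right_ne_zero_of_mul hne)
      · exact ⟨0, by simp, fun h => absurd h hx⟩
    choose σ hσB hσ using hs
    let T : Finset (X m) := z.support.filter fun x => x ∈ A m ∧ rank m x = r
    let w₁ : X (m + 1) →₀ ℤ := ∑ x ∈ T, z x • σ x
    have hw₁ : ∀ b ∈ w₁.support, b ∈ A (m + 1) ∪ B (m + 1) := by
      intro b hb
      rw [Finsupp.mem_support_iff, Finsupp.finsetSum_apply] at hb
      obtain ⟨x, -, hx⟩ := Finset.exists_ne_zero_of_sum_ne_zero hb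
      rw [Finsupp.smul_apply, smul_eq_mul] at hx
      exact Or.inr (hσB x b (Finsupp.mem_support_iff.2 (right_ne_zero_of_mul hx)))
    have hd : ∀ y, d m w₁ y = ∑ x ∈ T, z x * d m (σ x) y := by
      intro y
      simp [w₁, map_sum, Finsupp.finsetSum_apply]
    have hz' : ∀ x ∈ (z - d m w₁).support, x ∈ A m ∪ B m := by
      intro x hx
      rcases Finset.mem_union.1 (Finsupp.support_sub hx) with h | h
      · exact hz x h
      · exact M.bdry_mem hw₁ x h
    obtain ⟨w₂, hw₂, hzw⟩ := ih (z - d m w₁) hz' (by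
      intro y hy hyA
      by_contra! hr'
      have hzero : ∀ x ∈ T, x ≠ y → z x * d m (σ x) y = 0 := by
        intro x hx hxy
        by_contra hne
        obtain ⟨-, hxA, hxr⟩ := Finset.mem_filter.1 hx
        have := (hσ x hxA).2 y hyA (Ne.symm hxy) (right_ne_zero_of_mul hne)
        omega
      apply Finsupp.mem_support_iff.1 hy
      rw [Finsupp.sub_apply, hd]
      by_cases hyT : y ∈ T
      · rw [Finset.sum_eq_single_of_mem y hyT hzero, (hσ y hyA).1, mul_one, sub_self]
      · rw [Finset.sum_eq_zero fun x hx => hzero x hx (by rintro rfl; exact hyT hx), sub_zero]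
        by_contra hzy
        have hys := Finsupp.mem_support_iff.2 hzy
        have := hr y hys hyA
        exact hyT (Finset.mem_filter.2 ⟨hys, hyA, by omega⟩))
    refine ⟨w₁ + w₂, ?_, ?_⟩
    · intro x hx
      exact (Finset.mem_union.1 (Finsupp.support_add hx)).elim (hw₁ x) (hw₂ x)
    · rwa [map_add, ← sub_sub]

/-- A cycle supported in `B` vanishes: among the partners of its cells, one of largest rank would
have nonzero coefficient in the boundary. -/
lemma eq_zero_of_isFreeCycle (M : CellMatching d A B split rank) {m : ℕ} (z : X m →₀ ℤ)
    (hz : ∀ x ∈ z.support, x ∈ B m) (hc : IsFreeCycle d z) : z = 0 := by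
  by_contra hne
  have hs := Finsupp.support_nonempty_iff.2 hne
  cases m with
  | zero => exact M.not_mem_zero _ (hz _ hs.choose_spec)
  | succ m =>
    -- `low b` is the cell matched with `b`
    choose low hlow using M.surjective m
    obtain ⟨b, hb, hmax⟩ := z.support.attach.exists_max_image
      (fun x => rank m (low ⟨x, hz x x.2⟩)) (Finset.attach_nonempty_iff.2 hs)
    have h := linearMap_apply_eq_sum (d m) z (low ⟨b, hz b b.2⟩)
    have hc' : d m z = 0 := hc
    rw [hc', Finset.sum_eq_single_of_mem b.1 b.2] at h
    · have hu := M.isUnit m (low ⟨b, hz b b.2⟩)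
      rw [hlow] at hu
      exact (mul_ne_zero (Finsupp.mem_support_iff.1 b.2) hu.ne_zero) h.symm
    · intro x hx hxb
      by_contra hxne
      refine absurd (M.rank_lt m (low ⟨x, hz x hx⟩) (low ⟨b, hz b b.2⟩) ?_ ?_)
        (hmax ⟨x, hx⟩ (Finset.mem_attach _ _)).not_gt
      · intro he
        have := congrArg (split m) he
        rw [hlow, hlow, Subtype.mk_eq_mk] at this
        exact hxb this.symm
      · rw [hlow]
        exact right_ne_zero_of_mul hxne

/-- The subcomplex of the matched cells is acyclic. -/
theorem exists_bdry_eq (M : CellMatching d A B split rank)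
    (hdd : ∀ m z, d m (d (m + 1) z) = 0) {m : ℕ} (z : X m →₀ ℤ)
    (hz : ∀ x ∈ z.support, x ∈ A m ∪ B m) (hc : IsFreeCycle d z) :
    ∃ w : X (m + 1) →₀ ℤ, (∀ x ∈ w.support, x ∈ A (m + 1) ∪ B (m + 1)) ∧ d m w = z := by
  obtain ⟨w, hw, hzw⟩ := M.exists_sub_bdry_mem (z.support.sup (rank m) + 1) z hz
    fun x hx _ => Nat.lt_succ_of_le (Finset.le_sup hx)
  refine ⟨w, hw, (sub_eq_zero.1 (M.eq_zero_of_isFreeCycle _ hzw ?_)).symm⟩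
  cases m with
  | zero => trivial
  | succ m =>
    have hc' : d m z = 0 := hc
    show d m (z - d (m + 1) w) = 0
    rw [map_sub, hc', hdd, sub_zero]

end CellMatching

/-! ### Homology of the complex in terms of cycles and boundaries -/

section Homology

variable {n t u v : ℕ} {O : Fin u → Finset (Fin t)} {E : Fin v → Finset (Fin t)}

lemma deltaByBlocks_d (m : ℕ) : (deltaByBlocks n O E).d (m + 1) m =
    ModuleCat.ofHom (DeltaCell.bdryMap n O E m) :=
  ChainComplex.of_d (fun m => ModuleCat.of ℤ (DeltaCell n O E m →₀ ℤ))
    (fun m => ModuleCat.ofHom (DeltaCell.bdryMap n O E m)) m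

lemma deltaByBlocks_exactAt (m : ℕ)
    (h : ∀ z : DeltaCell n O E m →₀ ℤ, IsFreeCycle (DeltaCell.bdryMap n O E) z →
      ∃ w, DeltaCell.bdryMap n O E m w = z) : (deltaByBlocks n O E).ExactAt m := by
  cases m with
  | zero =>
    rw [HomologicalComplex.exactAt_iff' _ 1 0 0 (by simp) (by simp),
      ShortComplex.moduleCat_exact_iff]
    intro z _
    obtain ⟨w, hw⟩ := h z trivial
    refine ⟨w, ?_⟩
    change ((deltaByBlocks n O E).d (0 + 1) 0).hom w = z
    rw [deltaByBlocks_d]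
    exact hw
  | succ m =>
    rw [HomologicalComplex.exactAt_iff' _ (m + 1 + 1) (m + 1) m (by simp) (by simp),
      ShortComplex.moduleCat_exact_iff]
    intro z hz
    change ((deltaByBlocks n O E).d (m + 1) m).hom z = 0 at hz
    rw [deltaByBlocks_d] at hz
    obtain ⟨w, hw⟩ := h z hz
    refine ⟨w, ?_⟩
    change ((deltaByBlocks n O E).d (m + 1 + 1) (m + 1)).hom w = z
    rw [deltaByBlocks_d]
    exact hw

lemma deltaComplex_exactAt (i : ℤ)
    (h : ∀ m : ℕ, (m : ℤ) - 1 = i → ∀ z : DeltaCell n O E m →₀ ℤ,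
      IsFreeCycle (DeltaCell.bdryMap n O E) z → ∃ w, DeltaCell.bdryMap n O E m w = z) :
    (deltaComplex n O E).ExactAt i := by
  by_cases hi : ∃ m : ℕ, (m : ℤ) - 1 = i
  · obtain ⟨m, hm⟩ := hi
    exact (HomologicalComplex.extend_exactAt_iff _ blocksToDegree hm).2
      (deltaByBlocks_exactAt m (h m hm))
  · exact HomologicalComplex.extend_exactAt _ blocksToDegree i fun m hm => hi ⟨m, hm⟩

/-- If every cycle with `m` blocks is a unique multiple of `g` and no nonzero chain with `m` blocks
is a boundary, the homology in degree `m - 1` is infinite cyclic. -/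
lemma deltaComplex_homology_iso (m : ℕ) (h0 : DeltaCell.bdryMap n O E m = 0)
    (g : DeltaCell n O E m →₀ ℤ) (hg : IsFreeCycle (DeltaCell.bdryMap n O E) g)
    (h : ∀ z : DeltaCell n O E m →₀ ℤ, IsFreeCycle (DeltaCell.bdryMap n O E) z →
      ∃! k : ℤ, k • g = z) :
    Nonempty ((deltaComplex n O E).homology ((m : ℤ) - 1) ≅ ModuleCat.of ℤ ℤ) := by
  have hker : ∀ z : DeltaCell n O E m →₀ ℤ, ((deltaByBlocks n O E).sc m).g.hom z = 0 ↔
      IsFreeCycle (DeltaCell.bdryMap n O E) z := by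
    intro z
    cases m with
    | zero =>
      refine iff_of_true ?_ trivial
      change ((deltaByBlocks n O E).d 0 _).hom z = 0
      rw [(deltaByBlocks n O E).shape 0 _ (by simp)]
      rfl
    | succ m =>
      have hn : (ComplexShape.down ℕ).next (m + 1) = m := by simp
      change ((deltaByBlocks n O E).d (m + 1) ((ComplexShape.down ℕ).next (m + 1))).hom z = 0 ↔ _
      rw [hn, deltaByBlocks_d]
      rfl
  let φ : ℤ →ₗ[ℤ] LinearMap.ker ((deltaByBlocks n O E).sc m).g.hom :=
    LinearMap.toSpanSingleton ℤ _ ⟨g, (hker g).2 hg⟩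
  have hφ : Function.Bijective φ := by
    refine Function.bijective_iff_existsUnique _ |>.2 fun z => ?_
    obtain ⟨k, hk, hk'⟩ := h z.1 ((hker z.1).1 z.2)
    exact ⟨k, Subtype.ext hk, fun l hl => hk' l (congrArg Subtype.val hl)⟩
  have hd : (deltaByBlocks n O E).d (m + 1) m = 0 := by
    rw [deltaByBlocks_d, h0]
    rfl
  exact ⟨HomologicalComplex.extendHomologyIso _ blocksToDegree rfl ≪≫
    ((deltaByBlocks n O E).isoHomologyπ (m + 1) m (by simp) hd).symm ≪≫
    ShortComplex.moduleCatCyclesIso _ ≪≫ (LinearEquiv.ofBijective φ hφ).toModuleIso.symm⟩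

end Homology

/-! ### Faces -/

namespace DeltaCell

section Faces

variable {t u v : ℕ} {n : ℕ} {O : Fin u → Finset (Fin t)} {E : Fin v → Finset (Fin t)}

open Classical in
lemma optChain_apply {m : ℕ} (o : Option (BlockPair t m)) (c : DeltaCell n O E m) :
    optChain n O E o c = if o = some c.1 then 1 else 0 := by
  rcases o with _ | q
  · simp [optChain]
  · simp only [optChain, Option.elim_some, Option.some_inj, chain]
    split_ifs with h1 h2 h2
    · rw [Finsupp.single_apply, if_pos (Subtype.ext h2)]
    · rw [Finsupp.single_apply, if_neg fun h => h2 (congrArg Subtype.val h)]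
    · exact absurd (h2 ▸ c.2) h1
    · rfl

open Classical in
lemma bdryMap_single_apply {m : ℕ} (c : DeltaCell n O E (m + 1)) (c' : DeltaCell n O E m) :
    bdryMap n O E m (Finsupp.single c 1) c' =
      ∑ i : Fin (m + 1), if face i c.1 = some c'.1 then (-1 : ℤ) ^ ((i : ℕ) + 1) else 0 := by
  rw [bdryMap_eq, LinearMap.sum_apply, Finsupp.finsetSum_apply]
  refine Finset.sum_congr rfl fun i _ => ?_
  simp [faceMap, optChain_apply]

lemma exists_face_of_bdryMap_ne_zero {m : ℕ} {c : DeltaCell n O E (m + 1)} {c' : DeltaCell n O E m}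
    (h : bdryMap n O E m (Finsupp.single c 1) c' ≠ 0) : ∃ i, face i c.1 = some c'.1 := by
  classical
  rw [bdryMap_single_apply] at h
  obtain ⟨i, -, hi⟩ := Finset.exists_ne_zero_of_sum_ne_zero h
  exact ⟨i, by_contra fun hne => hi (if_neg hne)⟩

lemma isUnit_bdryMap {m : ℕ} {c : DeltaCell n O E (m + 1)} {c' : DeltaCell n O E m}
    (i : Fin (m + 1)) (hi : face i c.1 = some c'.1)
    (huniq : ∀ k, face k c.1 = some c'.1 → k = i) :
    IsUnit (bdryMap n O E m (Finsupp.single c 1) c') := by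
  classical
  rw [bdryMap_single_apply, Finset.sum_eq_single_of_mem i (Finset.mem_univ i), if_pos hi]
  · exact (isUnit_one.neg).pow _
  · exact fun k _ hk => if_neg fun h => hk (huniq k h)

lemma bdryMap_bdryMap (m : ℕ) (z : DeltaCell n O E (m + 2) →₀ ℤ) :
    bdryMap n O E m (bdryMap n O E (m + 1) z) = 0 :=
  LinearMap.congr_fun (bdryMap_comp n O E m) z

lemma face_size {m : ℕ} {k : Fin (m + 1)} {p : BlockPair t (m + 1)} {q : BlockPair t m}
    (hq : face k p = some q) (j : Fin m) :
    q.size j = if (j : ℕ) < k then p.size j.castSucc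
      else if (j : ℕ) = k then p.size j.castSucc + p.size j.succ else p.size j.succ := by
  induction k using Fin.lastCases with
  | cast k =>
    rw [face_castSucc, Option.some_inj] at hq
    subst hq
    simp only [BlockPair.merge, Fin.lt_def, Fin.ext_iff, Fin.val_castSucc]
    split_ifs with h1 h2
    · rfl
    · rw [Fin.ext h2]
    · rfl
  | last =>
    rw [face_last] at hq
    split_ifs at hq with h
    rw [Option.some_inj] at hq
    subst hq
    rw [Fin.val_last, if_pos j.2]
    rfl

/-- A face that does not touch the block of `x` preserves the size of this block. -/
lemma face_size_pos_eq {m : ℕ} {k : Fin (m + 1)} {p : BlockPair t (m + 1)} {q : BlockPair t m}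
    (hq : face k p = some q) (x : Fin t) (h : (k : ℕ) ≠ p.pos x) (h' : (k : ℕ) + 1 ≠ p.pos x) :
    q.size (q.pos x) = p.size (p.pos x) := by
  have hx := face_pos hq x
  rw [face_size hq]
  have e : ∀ a b : Fin (m + 1), (a : ℕ) = b → p.size a = p.size b :=
    fun a b h => congrArg _ (Fin.ext h)
  split_ifs at hx ⊢ <;> first
    | omega
    | (apply e; simp only [Fin.val_castSucc, Fin.val_succ]; omega)

/-- An element in a block of size `1` is alone in it. -/
lemma pos_ne_of_size_eq_one {m : ℕ} {p : BlockPair t m} (hp : p.IsBasic n O E) {x y : Fin t}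
    (hx : p.size (p.pos x) = 1) (hxy : y ≠ x) : p.pos y ≠ p.pos x := by
  intro h
  have := hp.card_le (p.pos x)
  rw [hx, Finset.card_le_one] at this
  exact hxy (this y (by simpa using h) x (by simp))

/-! ### The simplex on `n` vertices -/

/-- A last block is added that brings the sum to `n`; it has size `0`, and the result is no basis
element, if the sum is already at least `n`. -/
def fill {m : ℕ} (n : ℕ) (p : BlockPair 0 m) : BlockPair 0 (m + 1) where
  size := Fin.snoc (α := fun _ => ℕ) p.size (n - ∑ j, p.size j)
  pos x := x.elim0

lemma isBasic_of_zero {n m : ℕ} {O : Fin u → Finset (Fin 0)} {E : Fin v → Finset (Fin 0)}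
    {p : BlockPair 0 m} (h : ∀ j, 1 ≤ p.size j) (h' : ∑ j, p.size j ≤ n) : p.IsBasic n O E :=
  ⟨h, Nat.zero_le _, h', fun _ => by simp, fun _ x => x.elim0, fun _ x => x.elim0⟩

lemma face_last_fill {m : ℕ} (p : BlockPair 0 m) : face (Fin.last m) (fill n p) = some p := by
  rw [face_last, dif_pos fun x => x.elim0]
  congr 1
  ext k
  · simp [BlockPair.dropLast, fill]
  · exact k.elim0

lemma sum_fill {m : ℕ} (p : BlockPair 0 m) (h : ∑ j, p.size j ≤ n) :
    ∑ j, (fill n p).size j = n := by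
  simp only [fill, Fin.sum_univ_castSucc, Fin.snoc_castSucc, Fin.snoc_last]
  omega

lemma fill_of_face_last {m : ℕ} {p : BlockPair 0 (m + 1)} {q : BlockPair 0 m}
    (h : face (Fin.last m) p = some q) (hp : ∑ j, p.size j = n) : fill n q = p := by
  have hq : ∀ j, q.size j = p.size j.castSucc := by
    intro j
    rw [face_size h, Fin.val_last, if_pos j.2]
  ext k
  · induction k using Fin.lastCases with
    | cast k => simp [fill, hq]
    | last =>
      rw [Fin.sum_univ_castSucc] at hp
      simp only [fill, Fin.snoc_last, hq]
      omega
  · exact k.elim0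

lemma sum_eq_of_face_castSucc {m : ℕ} {k : Fin m} {p : BlockPair t (m + 1)} {q : BlockPair t m}
    (h : face k.castSucc p = some q) : ∑ j, q.size j = ∑ j, p.size j := by
  rw [face_castSucc, Option.some_inj] at h
  subst h
  simp only [merge_size]
  rw [Finset.sum_fiberwise]

lemma face_eq_last_of_sum_ne {m : ℕ} {k : Fin (m + 1)} {p : BlockPair t (m + 1)}
    {q : BlockPair t m} (h : face k p = some q) (hne : ∑ j, q.size j ≠ ∑ j, p.size j) :
    k = Fin.last m := by
  induction k using Fin.lastCases with
  | cast k => exact absurd (sum_eq_of_face_castSucc h) hne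
  | last => rfl

/-- The simplex with `n > 0` vertices has no reduced homology. -/
lemma exists_bdry_eq_of_zero (hn : 0 < n) {O : Fin u → Finset (Fin 0)}
    {E : Fin v → Finset (Fin 0)} {m : ℕ} (z : DeltaCell n O E m →₀ ℤ)
    (hz : IsFreeCycle (bdryMap n O E) z) : ∃ w, bdryMap n O E m w = z := by
  let A : ∀ m, Set (DeltaCell n O E m) := fun _ => {c | ∑ j, c.1.size j < n}
  let B : ∀ m, Set (DeltaCell n O E m) := fun _ => {c | ∑ j, c.1.size j = n}
  have hAB : ∀ m (c : DeltaCell n O E m), c ∈ A m ∪ B m := fun m c => c.2.sum_le.lt_or_eq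
  have hfill : ∀ m (a : A m), (fill n a.1.1).IsBasic n O E := by
    intro m a
    refine isBasic_of_zero ?_ (sum_fill _ a.1.2.sum_le).le
    intro j
    have ha : ∑ j, a.1.1.size j < n := a.2
    induction j using Fin.lastCases with
    | cast j => simpa [fill] using a.1.2.size_pos j
    | last =>
      simp only [fill, Fin.snoc_last]
      omega
  let split : ∀ m, A m → B (m + 1) := fun m a =>
    ⟨⟨fill n a.1.1, hfill m a⟩, sum_fill _ a.1.2.sum_le⟩
  have key : ∀ m (a a' : A m) (i : Fin (m + 1)), face i (split m a).1.1 = some a'.1.1 →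
      i = Fin.last m ∧ a' = a := by
    intro m a a' i hi
    have hB : ∑ j, (split m a).1.1.size j = n := (split m a).2
    have hA : ∑ j, a'.1.1.size j < n := a'.2
    obtain rfl := face_eq_last_of_sum_ne hi (by omega)
    refine ⟨rfl, ?_⟩
    have := (face_last_fill (n := n) a.1.1).symm.trans hi
    exact Subtype.ext (Subtype.ext (Option.some_inj.1 this).symm)
  have M : CellMatching (bdryMap n O E) A B split fun _ _ => 0 := by
    refine ⟨?_, ?_, ?_, ?_, fun m _ _ y _ => hAB m y⟩
    · intro c hc
      have hc' : ∑ j, c.1.size j = n := hc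
      simp at hc'
      omega
    · rintro m ⟨b, hb⟩
      have hface := face_last b.1
      rw [dif_pos fun x => x.elim0] at hface
      have hb' : ∑ j, b.1.size j = n := hb
      have hlt : ∑ j, (b.1.dropLast fun x => x.elim0).size j < n := by
        have := b.2.size_pos (Fin.last m)
        rw [Fin.sum_univ_castSucc] at hb'
        simp only [BlockPair.dropLast]
        omega
      exact ⟨⟨⟨_, isBasic_of_zero (fun j => b.2.size_pos j.castSucc) hlt.le⟩, hlt⟩,
        Subtype.ext (Subtype.ext (fill_of_face_last hface hb))⟩
    · exact fun m a => isUnit_bdryMap (Fin.last m) (face_last_fill _) fun k hk => (key m a a k hk).1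
    · intro m a a' hne h
      obtain ⟨i, hi⟩ := exists_face_of_bdryMap_ne_zero h
      exact absurd (key m a a' i hi).2 hne
  obtain ⟨w, -, hw⟩ := M.exists_bdry_eq bdryMap_bdryMap z (fun x _ => hAB m x) hz
  exact ⟨w, hw⟩

end Faces

/-! ### Moving the element `0` into a block of its own -/

section InsertZero

variable {t u v n m : ℕ} {O : Fin u → Finset (Fin (t + 1))} {E : Fin v → Finset (Fin (t + 1))}

/-- The element `0` leaves its block, which shrinks by one, and forms a new block of size `1` at
position `s`. -/
def insertZero (s : Fin (m + 1)) (p : BlockPair (t + 1) m) : BlockPair (t + 1) (m + 1) where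
  size := Fin.insertNth (α := fun _ => ℕ) s 1
    (Function.update p.size (p.pos 0) (p.size (p.pos 0) - 1))
  pos := Fin.cons (α := fun _ => Fin (m + 1)) s fun x => s.succAbove (p.pos x.succ)

lemma insertZero_pos_zero (s : Fin (m + 1)) (p : BlockPair (t + 1) m) :
    (insertZero s p).pos 0 = s := rfl

lemma insertZero_pos_succ (s : Fin (m + 1)) (p : BlockPair (t + 1) m) (x : Fin t) :
    (insertZero s p).pos x.succ = s.succAbove (p.pos x.succ) := rfl

lemma insertZero_size_self (s : Fin (m + 1)) (p : BlockPair (t + 1) m) :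
    (insertZero s p).size s = 1 := by
  simp [insertZero]

lemma insertZero_size_succAbove (s : Fin (m + 1)) (p : BlockPair (t + 1) m) (j : Fin m) :
    (insertZero s p).size (s.succAbove j) =
      if j = p.pos 0 then p.size (p.pos 0) - 1 else p.size j := by
  simp [insertZero, Function.update_apply]

lemma val_succAbove (s : Fin (m + 1)) (j : Fin m) :
    (s.succAbove j : ℕ) = if (j : ℕ) < s then (j : ℕ) else j + 1 := by
  unfold Fin.succAbove
  simp only [Fin.lt_def, Fin.val_castSucc]
  split_ifs <;> simp

/-- If the new block is next to the old one, merging both undoes `insertZero`. -/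
lemma face_insertZero (s : Fin (m + 1)) (p : BlockPair (t + 1) m) (h : 1 ≤ p.size (p.pos 0))
    (hs : (s : ℕ) = p.pos 0 ∨ (s : ℕ) = p.pos 0 + 1) :
    face (p.pos 0).castSucc (insertZero s p) = some p := by
  rw [face_castSucc]
  congr 1
  ext j
  · have hlt : ∀ k : Fin (m + 1), ∀ l : Fin m, (k : ℕ) = s.succAbove l →
        (insertZero s p).size k = if l = p.pos 0 then p.size (p.pos 0) - 1 else p.size l := by
      intro k l hkl
      rw [Fin.ext hkl, insertZero_size_succAbove]
    have hself : ∀ k : Fin (m + 1), (k : ℕ) = s → (insertZero s p).size k = 1 := by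
      intro k hk
      rw [Fin.ext hk, insertZero_size_self]
    simp only [BlockPair.merge, Fin.lt_def]
    split_ifs with h1 h2
    · rw [hlt j.castSucc j, if_neg (by rintro rfl; omega)]
      rw [val_succAbove, Fin.val_castSucc, if_pos (by omega)]
    · subst h2
      rcases hs with hs | hs
      · rw [hself (p.pos 0).castSucc (by simp [hs]), hlt (p.pos 0).succ (p.pos 0), if_pos rfl]
        · omega
        · rw [val_succAbove, Fin.val_succ, if_neg (by omega)]
      · rw [hself (p.pos 0).succ (by simp [hs]), hlt (p.pos 0).castSucc (p.pos 0), if_pos rfl]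
        · omega
        · rw [val_succAbove, Fin.val_castSucc, if_pos (by omega)]
    · have h3 : (j : ℕ) ≠ p.pos 0 := fun h => h2 (Fin.ext h)
      rw [hlt j.succ j, if_neg h2]
      rw [val_succAbove, Fin.val_succ, if_neg (by omega)]
  · simp only [BlockPair.merge, val_predAbove]
    induction j using Fin.cases with
    | zero =>
      rw [insertZero_pos_zero]
      split_ifs <;> omega
    | succ x =>
      rw [insertZero_pos_succ, val_succAbove]
      split_ifs <;> omega

/-- If `0` is alone in its block, `insertZero` undoes the merging of this block with a neighbour. -/
lemma insertZero_of_face (p : BlockPair (t + 1) (m + 1)) (q : BlockPair (t + 1) m)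
    (j : Fin m) (hj : (p.pos 0 : ℕ) = j ∨ (p.pos 0 : ℕ) = j + 1)
    (h : face j.castSucc p = some q) (h1 : p.size (p.pos 0) = 1)
    (hpos : ∀ x, x ≠ 0 → p.pos x ≠ p.pos 0) : insertZero (p.pos 0) q = p := by
  have hq0 : q.pos 0 = j := by
    rw [Fin.ext_iff, face_pos h, Fin.val_castSucc]
    split_ifs <;> omega
  have hlast : ∀ k l : Fin (m + 1), (k : ℕ) = l → p.size k = p.size l :=
    fun k l h => congrArg _ (Fin.ext h)
  ext k
  · rcases Fin.eq_self_or_eq_succAbove (p.pos 0) k with rfl | ⟨l, rfl⟩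
    · rw [insertZero_size_self, h1]
    · have hl := val_succAbove (p.pos 0) l
      rw [insertZero_size_succAbove, hq0]
      split_ifs with hlj
      · subst hlj
        rw [face_size h, if_neg (by simp), if_pos (by simp)]
        rcases hj with hj | hj
        · rw [if_neg (by omega)] at hl
          rw [hlast l.castSucc (p.pos 0) (by simp [hj]), h1,
            hlast l.succ ((p.pos 0).succAbove l) (by rw [Fin.val_succ, hl]),
            Nat.add_sub_cancel_left]
        · rw [if_pos (by omega)] at hl
          rw [hlast l.succ (p.pos 0) (by simp [hj]), h1,
            hlast l.castSucc ((p.pos 0).succAbove l) (by rw [Fin.val_castSucc, hl]),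
            Nat.add_sub_cancel]
      · have hlj' : (l : ℕ) ≠ j := fun h => hlj (Fin.ext h)
        rw [face_size h, Fin.val_castSucc]
        split_ifs at hl ⊢ <;> first
          | omega
          | (apply hlast; simp only [Fin.val_castSucc, Fin.val_succ]; omega)
  · induction k using Fin.cases with
    | zero => rfl
    | succ x =>
      have hx : (p.pos x.succ : ℕ) ≠ p.pos 0 := fun h => hpos _ (Fin.succ_ne_zero x) (Fin.ext h)
      rw [insertZero_pos_succ, val_succAbove, face_pos h, Fin.val_castSucc]
      split_ifs <;> omega

/-- Splitting off `0` to the left always respects the order conditions, as `0` is the least element.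
Splitting it off to the right may violate the weak condition only. -/
lemma isBasic_insertZero {s : Fin (m + 1)} {p : BlockPair (t + 1) m} (hp : p.IsBasic n O E)
    (h : 2 ≤ p.size (p.pos 0))
    (hs : (s : ℕ) = p.pos 0 ∨ (s : ℕ) = p.pos 0 + 1 ∧ ∀ i, 0 ∉ E i) :
    (insertZero s p).IsBasic n O E := by
  have hcard : ∀ j, (Finset.univ.filter fun x => (insertZero s p).pos x = j).card ≤
      (insertZero s p).size j := by
    intro k
    rcases Fin.eq_self_or_eq_succAbove s k with rfl | ⟨l, rfl⟩
    · rw [insertZero_size_self, Finset.card_le_one]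
      have h0 : ∀ x ∈ Finset.univ.filter fun x => (insertZero k p).pos x = k, x = 0 := by
        intro x hx
        induction x using Fin.cases with
        | zero => rfl
        | succ x => exact absurd (Finset.mem_filter.1 hx).2 (Fin.succAbove_ne _ _)
      exact fun x hx y hy => (h0 x hx).trans (h0 y hy).symm
    · have he : (Finset.univ.filter fun x => (insertZero s p).pos x = s.succAbove l) =
          (Finset.univ.filter fun x => p.pos x = l).erase 0 := by
        ext x
        induction x using Fin.cases with
        | zero => simp [insertZero_pos_zero]
        | succ x => simp [insertZero_pos_succ]
      rw [he, insertZero_size_succAbove]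
      split_ifs with hl
      · subst hl
        rw [Finset.card_erase_of_mem (by simp)]
        exact Nat.sub_le_sub_right (hp.card_le _) 1
      · exact (Finset.card_le_card (Finset.erase_subset _ _)).trans (hp.card_le l)
  have hsum : ∑ j, (insertZero s p).size j = ∑ j, p.size j := by
    have h2 : p.size (p.pos 0) + ∑ j ∈ Finset.univ.erase (p.pos 0), p.size j = ∑ j, p.size j :=
      Finset.add_sum_erase _ _ (Finset.mem_univ _)
    rw [Fin.sum_univ_succAbove _ s, insertZero_size_self]
    simp only [insertZero_size_succAbove]
    have h3 : ∑ j ∈ Finset.univ.erase (p.pos 0),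
        (if j = p.pos 0 then p.size (p.pos 0) - 1 else p.size j) =
          ∑ j ∈ Finset.univ.erase (p.pos 0), p.size j :=
      Finset.sum_congr rfl fun j hj => if_neg (Finset.ne_of_mem_erase hj)
    rw [← Finset.add_sum_erase _ _ (Finset.mem_univ (p.pos 0)), if_pos rfl, h3]
    omega
  refine ⟨?_, le_sum_of_card hcard, hsum.le.trans hp.sum_le, hcard, ?_, ?_⟩
  · intro k
    rcases Fin.eq_self_or_eq_succAbove s k with rfl | ⟨l, rfl⟩
    · rw [insertZero_size_self]
    · rw [insertZero_size_succAbove]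
      split_ifs
      · omega
      · exact hp.size_pos l
  · intro i x hx y hy hxy
    have hlt := hp.strict i x hx y hy hxy
    rw [Fin.lt_def] at hlt ⊢
    induction y using Fin.cases with
    | zero => exact absurd hxy (Fin.not_lt_zero x)
    | succ y =>
      rw [insertZero_pos_succ, val_succAbove]
      induction x using Fin.cases with
      | zero =>
        rw [insertZero_pos_zero]
        split_ifs <;> omega
      | succ x =>
        rw [insertZero_pos_succ, val_succAbove]
        split_ifs <;> omega
  · intro i x hx y hy hxy
    have hle := hp.weak i x hx y hy hxy
    rw [Fin.le_def] at hle ⊢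
    induction y using Fin.cases with
    | zero => exact absurd hxy (Fin.not_lt_zero x)
    | succ y =>
      rw [insertZero_pos_succ, val_succAbove]
      induction x using Fin.cases with
      | zero =>
        have hs' : (s : ℕ) = p.pos 0 := hs.resolve_right fun h => h.2 i hx
        rw [insertZero_pos_zero]
        split_ifs <;> omega
      | succ x =>
        rw [insertZero_pos_succ, val_succAbove]
        split_ifs <;> omega

/-- Merging the block of `0` with a neighbour yields a basis element, if `0` is alone in its block
and this neighbour may receive it. -/
lemma isBasic_of_face {k : Fin (m + 1)} {p : BlockPair (t + 1) (m + 1)} {q : BlockPair (t + 1) m}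
    (hp : p.IsBasic n O E) (hq : face k p = some q) (h1 : p.size (p.pos 0) = 1)
    (hk : (k : ℕ) + 1 = p.pos 0 ∨ (k : ℕ) = p.pos 0 ∧ ∀ i, 0 ∉ O i) : q.IsBasic n O E := by
  have hc := face_card hq hp.card_le
  refine ⟨face_size_pos hq hp.size_pos, le_sum_of_card hc, (face_sum hq).trans hp.sum_le, hc,
    ?_, ?_⟩
  · intro i x hx y hy hxy
    have hlt := hp.strict i x hx y hy hxy
    have hy0 : (p.pos y : ℕ) ≠ p.pos 0 :=
      fun h => pos_ne_of_size_eq_one hp h1 (by rintro rfl; exact Fin.not_lt_zero x hxy) (Fin.ext h)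
    have hx0 : 0 ∈ O i ∨ (p.pos x : ℕ) ≠ p.pos 0 := by
      by_cases h : x = 0
      · exact Or.inl (h ▸ hx)
      · exact Or.inr fun h' => pos_ne_of_size_eq_one hp h1 h (Fin.ext h')
    have hk' : (k : ℕ) + 1 = p.pos 0 ∨ (k : ℕ) = p.pos 0 ∧ 0 ∉ O i :=
      hk.imp_right fun h => ⟨h.1, h.2 i⟩
    rw [Fin.lt_def] at hlt ⊢
    rw [face_pos hq, face_pos hq]
    rcases hk' with hk' | ⟨hk', h0⟩
    · split_ifs <;> omega
    · have := hx0.resolve_left h0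
      split_ifs <;> omega
  · intro i x hx y hy hxy
    have hle := hp.weak i x hx y hy hxy
    rw [Fin.le_def] at hle ⊢
    rw [face_pos hq, face_pos hq]
    split_ifs <;> omega

end InsertZero

/-! ### Matchings that move the element `0` -/

section Matchings

variable {t u v n : ℕ} {O : Fin u → Finset (Fin (t + 1))} {E : Fin v → Finset (Fin (t + 1))}

/-- The cells in which the block of `0` can be split further. -/
def splittable (n : ℕ) (O : Fin u → Finset (Fin (t + 1))) (E : Fin v → Finset (Fin (t + 1)))
    (m : ℕ) : Set (DeltaCell n O E m) :=
  {c | 2 ≤ c.1.size (c.1.pos 0)}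

lemma two_le_of_ne_one {m : ℕ} (c : DeltaCell n O E m) (h : c.1.size (c.1.pos 0) ≠ 1) :
    2 ≤ c.1.size (c.1.pos 0) := by
  have := c.2.size_pos (c.1.pos 0)
  omega

/-- A face that makes the singleton block of `0` splittable merges it with a neighbour. -/
lemma face_touches {m : ℕ} {k : Fin (m + 1)} {p : BlockPair (t + 1) (m + 1)}
    {q : BlockPair (t + 1) m} (h : face k p = some q) (hp : p.size (p.pos 0) = 1)
    (hq : 2 ≤ q.size (q.pos 0)) : (k : ℕ) = p.pos 0 ∨ (k : ℕ) + 1 = p.pos 0 := by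
  by_contra! hne
  have := face_size_pos_eq h 0 hne.1 hne.2
  omega

lemma two_le_size_of_merge {m : ℕ} {k : Fin m} {p : BlockPair (t + 1) (m + 1)}
    {q : BlockPair (t + 1) m} (hp : ∀ j, 1 ≤ p.size j) (h : face k.castSucc p = some q)
    (hk : (k : ℕ) = p.pos 0 ∨ (k : ℕ) + 1 = p.pos 0) :
    q.pos 0 = k ∧ 2 ≤ q.size (q.pos 0) := by
  have h0 : q.pos 0 = k := by
    rw [Fin.ext_iff, face_pos h, Fin.val_castSucc]
    split_ifs <;> omega
  refine ⟨h0, ?_⟩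
  rw [h0, face_size h, if_neg (by simp), if_pos (by simp)]
  have h1 := hp k.castSucc
  have h2 := hp k.succ
  omega

/-- If `0` is the least element of some `E i`, it can always be split off to the left, and merged
to the right since another element of `E i` follows. So every cell is matched. -/
lemma exists_bdry_eq_of_mem_weak {i₀ : Fin v} (h0 : 0 ∈ E i₀) (hcard : 2 ≤ (E i₀).card)
    (hO : ∀ i, 0 ∉ O i) {m : ℕ} (z : DeltaCell n O E m →₀ ℤ)
    (hz : IsFreeCycle (bdryMap n O E) z) : ∃ w, bdryMap n O E m w = z := by
  let A := splittable n O E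
  let B : ∀ m, Set (DeltaCell n O E m) := fun _ => {c | c.1.size (c.1.pos 0) = 1}
  have hAB : ∀ m (c : DeltaCell n O E m), c ∈ A m ∪ B m := by
    intro m c
    by_cases h : c.1.size (c.1.pos 0) = 1
    · exact Or.inr h
    · exact Or.inl (two_le_of_ne_one c h)
  let split : ∀ m, A m → B (m + 1) := fun m a =>
    ⟨⟨insertZero (a.1.1.pos 0).castSucc a.1.1, isBasic_insertZero a.1.2 a.2 (Or.inl rfl)⟩,
      insertZero_size_self _ _⟩
  have hface : ∀ m (a : A m), face (a.1.1.pos 0).castSucc (split m a).1.1 = some a.1.1 :=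
    fun m a => face_insertZero _ _ (a.1.2.size_pos _) (Or.inl rfl)
  have key : ∀ m (a a' : A m) (k : Fin (m + 1)), face k (split m a).1.1 = some a'.1.1 →
      k = (a.1.1.pos 0).castSucc ∨ (a'.1.1.pos 0 : ℕ) < a.1.1.pos 0 := by
    intro m a a' k hk
    have hpos : ((split m a).1.1.pos 0 : ℕ) = a.1.1.pos 0 := rfl
    have h := face_pos hk 0
    rw [hpos] at h
    rcases face_touches hk (split m a).2 a'.2 with h1 | h1 <;> rw [hpos] at h1
    · exact Or.inl (Fin.ext h1)
    · right
      split_ifs at h <;> omega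
  -- the only other splittable face of `split a` merges `{0}` to the left, moving `0` there
  have M : CellMatching (bdryMap n O E) A B split fun _ c => (c.1.pos 0 : ℕ) := by
    refine ⟨fun c => (c.1.pos 0).elim0, ?_, ?_, ?_, fun m _ _ y _ => hAB m y⟩
    · rintro m ⟨b, hb⟩
      have hb' : b.1.size (b.1.pos 0) = 1 := hb
      obtain ⟨y, hy, hy0⟩ := Finset.exists_mem_ne (Nat.lt_of_succ_le hcard) (0 : Fin (t + 1))
      have hle := b.2.weak i₀ 0 h0 y hy (Fin.pos_of_ne_zero hy0)
      have hlt : (b.1.pos 0 : ℕ) < b.1.pos y :=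
        lt_of_le_of_ne hle fun h => pos_ne_of_size_eq_one b.2 hb' hy0 (Fin.ext h.symm)
      have hm : (b.1.pos 0 : ℕ) < m := by
        have := (b.1.pos y).2
        omega
      let j : Fin m := ⟨b.1.pos 0, hm⟩
      have hq := face_castSucc j b.1
      obtain ⟨hq0, hq2⟩ := two_le_size_of_merge b.2.size_pos hq (Or.inl rfl)
      refine ⟨⟨⟨b.1.merge j, isBasic_of_face b.2 hq hb' (Or.inr ⟨rfl, hO⟩)⟩, hq2⟩,
        Subtype.ext (Subtype.ext ?_)⟩
      have hs : ((b.1.merge j).pos 0).castSucc = b.1.pos 0 := by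
        rw [hq0]
        rfl
      change insertZero ((b.1.merge j).pos 0).castSucc (b.1.merge j) = b.1
      rw [hs]
      exact insertZero_of_face _ _ j (Or.inl rfl) hq hb'
        fun x hx => pos_ne_of_size_eq_one b.2 hb' hx
    · exact fun m a => isUnit_bdryMap _ (hface m a) fun k hk =>
        (key m a a k hk).resolve_right (lt_irrefl _)
    · intro m a a' hne h
      obtain ⟨k, hk⟩ := exists_face_of_bdryMap_ne_zero h
      refine (key m a a' k hk).resolve_left ?_
      rintro rfl
      have := (hface m a).symm.trans hk
      exact hne (Subtype.ext (Subtype.ext (Option.some_inj.1 this).symm))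
  obtain ⟨w, -, hw⟩ := M.exists_bdry_eq bdryMap_bdryMap z (fun x _ => hAB m x) hz
  exact ⟨w, hw⟩

/-- The cells whose first block is not `{0}` with size `1`. -/
def noncritical (n : ℕ) (O : Fin u → Finset (Fin (t + 1))) (E : Fin v → Finset (Fin (t + 1)))
    (m : ℕ) : Set (DeltaCell n O E m) :=
  {c | c.1.size (c.1.pos 0) = 1 → (c.1.pos 0 : ℕ) ≠ 0}

/-- The noncritical cells span a subcomplex: no merging produces a first block of size `1`. -/
lemma noncritical_of_bdryMap_ne_zero {m : ℕ} {x : DeltaCell n O E (m + 1)}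
    (hx : x ∈ noncritical n O E (m + 1)) {y : DeltaCell n O E m}
    (hxy : bdryMap n O E m (Finsupp.single x 1) y ≠ 0) : y ∈ noncritical n O E m := by
  intro h1 h0
  obtain ⟨k, hk⟩ := exists_face_of_bdryMap_ne_zero hxy
  have hp := face_pos hk 0
  rw [face_size hk] at h1
  have h2 := x.2.size_pos (y.1.pos 0).castSucc
  have h3 := x.2.size_pos (y.1.pos 0).succ
  by_cases hk0 : (k : ℕ) = 0
  · rw [if_neg (by omega), if_pos (by omega)] at h1
    omega
  · rw [if_pos (by omega)] at h1
    have hx0 : (x.1.pos 0 : ℕ) = 0 := by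
      split_ifs at hp <;> omega
    have he : x.1.pos 0 = (y.1.pos 0).castSucc := Fin.ext (by rw [hx0, Fin.val_castSucc, h0])
    exact hx (he ▸ h1) hx0

/-- If `0` lies in no `E i`, it can always be split off to the right, and merged to the left unless
its block is the first one. So the cells whose first block is not `{0}` span an acyclic complex. -/
lemma exists_bdry_eq_of_noncritical (hE : ∀ i, 0 ∉ E i) {m : ℕ} (z : DeltaCell n O E m →₀ ℤ)
    (hz : IsFreeCycle (bdryMap n O E) z) (hzc : ∀ x ∈ z.support, x ∈ noncritical n O E m) :
    ∃ w, bdryMap n O E m w = z ∧ ∀ x ∈ w.support, x ∈ noncritical n O E (m + 1) := by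
  let A := splittable n O E
  let B : ∀ m, Set (DeltaCell n O E m) := fun _ =>
    {c | c.1.size (c.1.pos 0) = 1 ∧ (c.1.pos 0 : ℕ) ≠ 0}
  have hAB : ∀ m, A m ∪ B m = noncritical n O E m := by
    intro m
    ext c
    constructor
    · rintro (h | h) h1
      · have h' : 2 ≤ c.1.size (c.1.pos 0) := h
        omega
      · exact h.2
    · intro h
      by_cases h1 : c.1.size (c.1.pos 0) = 1
      · exact Or.inr ⟨h1, h h1⟩
      · exact Or.inl (two_le_of_ne_one c h1)
  let split : ∀ m, A m → B (m + 1) := fun m a =>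
    ⟨⟨insertZero (a.1.1.pos 0).succ a.1.1, isBasic_insertZero a.1.2 a.2 (Or.inr ⟨rfl, hE⟩)⟩,
      insertZero_size_self _ _, Nat.succ_ne_zero _⟩
  have hface : ∀ m (a : A m), face (a.1.1.pos 0).castSucc (split m a).1.1 = some a.1.1 :=
    fun m a => face_insertZero _ _ (a.1.2.size_pos _) (Or.inr rfl)
  have key : ∀ m (a a' : A m) (k : Fin (m + 1)), face k (split m a).1.1 = some a'.1.1 →
      k = (a.1.1.pos 0).castSucc ∨ (a.1.1.pos 0 : ℕ) < a'.1.1.pos 0 := by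
    intro m a a' k hk
    have hpos : ((split m a).1.1.pos 0 : ℕ) = a.1.1.pos 0 + 1 := rfl
    have h := face_pos hk 0
    rw [hpos] at h
    rcases face_touches hk (split m a).2.1 a'.2 with h1 | h1 <;> rw [hpos] at h1
    · right
      split_ifs at h <;> omega
    · exact Or.inl (Fin.ext (Nat.succ_injective h1))
  -- the only other splittable face of `split a` merges `{0}` to the right, moving `0` there
  have M : CellMatching (bdryMap n O E) A B split fun m c => m - (c.1.pos 0 : ℕ) := by
    refine ⟨fun c => (c.1.pos 0).elim0, ?_, ?_, ?_, ?_⟩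
    · rintro m ⟨b, hb⟩
      obtain ⟨hb1, hb0⟩ : b.1.size (b.1.pos 0) = 1 ∧ (b.1.pos 0 : ℕ) ≠ 0 := hb
      have hm : (b.1.pos 0 : ℕ) - 1 < m := by
        have := (b.1.pos 0).2
        omega
      let j : Fin m := ⟨b.1.pos 0 - 1, hm⟩
      have hj : (j : ℕ) + 1 = b.1.pos 0 := Nat.succ_pred_eq_of_ne_zero hb0
      have hq := face_castSucc j b.1
      obtain ⟨hq0, hq2⟩ := two_le_size_of_merge b.2.size_pos hq (Or.inr hj)
      refine ⟨⟨⟨b.1.merge j, isBasic_of_face b.2 hq hb1 (Or.inl hj)⟩, hq2⟩,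
        Subtype.ext (Subtype.ext ?_)⟩
      have hs : ((b.1.merge j).pos 0).succ = b.1.pos 0 := by
        rw [hq0]
        exact Fin.ext hj
      change insertZero ((b.1.merge j).pos 0).succ (b.1.merge j) = b.1
      rw [hs]
      exact insertZero_of_face _ _ j (Or.inr hj.symm) hq hb1
        fun x hx => pos_ne_of_size_eq_one b.2 hb1 hx
    · exact fun m a => isUnit_bdryMap _ (hface m a) fun k hk =>
        (key m a a k hk).resolve_right (lt_irrefl _)
    · intro m a a' hne h
      obtain ⟨k, hk⟩ := exists_face_of_bdryMap_ne_zero h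
      have hlt : (a.1.1.pos 0 : ℕ) < a'.1.1.pos 0 := by
        refine (key m a a' k hk).resolve_left ?_
        rintro rfl
        have := (hface m a).symm.trans hk
        exact hne (Subtype.ext (Subtype.ext (Option.some_inj.1 this).symm))
      have := (a'.1.1.pos 0).2
      change m - (a'.1.1.pos 0 : ℕ) < m - (a.1.1.pos 0 : ℕ)
      omega
    · intro m x hx y hxy
      rw [hAB] at hx ⊢
      exact noncritical_of_bdryMap_ne_zero hx hxy
  obtain ⟨w, hw, hwz⟩ := M.exists_bdry_eq bdryMap_bdryMap z
    (fun x hx => (hAB m).symm ▸ hzc x hx) hz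
  exact ⟨w, hwz, fun x hx => hAB (m + 1) ▸ hw x hx⟩

end Matchings

/-! ### The quotient spanned by the critical cells -/

section Critical

variable {t u v n : ℕ}

/-- The family induced on the elements other than `0`. -/
def restrictSucc {w : ℕ} (F : Fin w → Finset (Fin (t + 1))) : Fin w → Finset (Fin t) :=
  fun i => Finset.univ.filter fun x => x.succ ∈ F i

lemma mem_restrictSucc {w : ℕ} {F : Fin w → Finset (Fin (t + 1))} {i : Fin w} {x : Fin t} :
    x ∈ restrictSucc F i ↔ x.succ ∈ F i := by
  simp [restrictSucc]

lemma card_restrictSucc {w : ℕ} {F : Fin w → Finset (Fin (t + 1))} {i : Fin w} (h : 0 ∉ F i) :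
    (restrictSucc F i).card = (F i).card := by
  rw [← Finset.card_map (Fin.succEmb t)]
  congr 1
  ext x
  induction x using Fin.cases with
  | zero => simp [h, Fin.succ_ne_zero]
  | succ x => simp [mem_restrictSucc]

/-- A new first block `{0}` of size `1` is added. -/
def consZero {m : ℕ} (q : BlockPair t m) : BlockPair (t + 1) (m + 1) where
  size := Fin.cons (α := fun _ => ℕ) 1 q.size
  pos := Fin.cons (α := fun _ => Fin (m + 1)) 0 fun x => (q.pos x).succ

lemma consZero_pos_zero {m : ℕ} (q : BlockPair t m) : (consZero q).pos 0 = 0 := rfl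

lemma consZero_pos_succ {m : ℕ} (q : BlockPair t m) (x : Fin t) :
    (consZero q).pos x.succ = (q.pos x).succ := rfl

lemma consZero_injective {m : ℕ} : Function.Injective (consZero (t := t) (m := m)) := by
  intro q q' h
  ext k
  · exact congrFun (congrArg BlockPair.size h) k.succ
  · exact congrArg Fin.val (Fin.succ_injective _ (congrFun (congrArg BlockPair.pos h) k.succ))

variable {O : Fin u → Finset (Fin (t + 1))} {E : Fin v → Finset (Fin (t + 1))}

lemma card_consZero {m : ℕ} (q : BlockPair t m) (j : Fin m) :
    (Finset.univ.filter fun x => (consZero q).pos x = j.succ).card =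
      (Finset.univ.filter fun x => q.pos x = j).card := by
  rw [← Finset.card_map (Fin.succEmb t)]
  congr 1
  ext x
  induction x using Fin.cases with
  | zero => simp [consZero_pos_zero, Fin.succ_ne_zero, (Fin.succ_ne_zero j).symm]
  | succ x => simp [consZero_pos_succ]

lemma isBasic_consZero_iff {m : ℕ} (q : BlockPair t m) :
    (consZero q).IsBasic (n + 1) O E ↔ q.IsBasic n (restrictSucc O) (restrictSucc E) := by
  have hsum : ∑ j, (consZero q).size j = 1 + ∑ j, q.size j := by
    rw [Fin.sum_univ_succ]
    rfl
  constructor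
  · intro h
    have hc : ∀ j, (Finset.univ.filter fun x => q.pos x = j).card ≤ q.size j := by
      intro j
      rw [← card_consZero]
      exact h.card_le j.succ
    refine ⟨fun j => h.size_pos j.succ, le_sum_of_card hc, ?_, hc, ?_, ?_⟩
    · have := h.sum_le
      omega
    · intro i x hx y hy hxy
      exact Fin.succ_lt_succ_iff.1 (h.strict i x.succ (mem_restrictSucc.1 hx) y.succ
        (mem_restrictSucc.1 hy) (Fin.succ_lt_succ_iff.2 hxy))
    · intro i x hx y hy hxy
      exact Fin.succ_le_succ_iff.1 (h.weak i x.succ (mem_restrictSucc.1 hx) y.succ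
        (mem_restrictSucc.1 hy) (Fin.succ_lt_succ_iff.2 hxy))
  · intro h
    have hc : ∀ j, (Finset.univ.filter fun x => (consZero q).pos x = j).card ≤
        (consZero q).size j := by
      intro j
      induction j using Fin.cases with
      | zero =>
        refine (Finset.card_le_card (t := {0}) ?_).trans_eq (Finset.card_singleton 0)
        intro x hx
        induction x using Fin.cases with
        | zero => simp
        | succ x => exact absurd (Finset.mem_filter.1 hx).2 (Fin.succ_ne_zero _)
      | succ j =>
        rw [card_consZero]
        exact h.card_le j
    refine ⟨?_, le_sum_of_card hc, ?_, hc, ?_, ?_⟩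
    · intro j
      induction j using Fin.cases with
      | zero => exact le_rfl
      | succ j => exact h.size_pos j
    · have := h.sum_le
      omega
    · intro i x hx y hy hxy
      induction y using Fin.cases with
      | zero => exact absurd hxy (Fin.not_lt_zero x)
      | succ y =>
        induction x using Fin.cases with
        | zero => exact Fin.succ_pos _
        | succ x =>
          exact Fin.succ_lt_succ_iff.2 (h.strict i x (mem_restrictSucc.2 hx) y
            (mem_restrictSucc.2 hy) (Fin.succ_lt_succ_iff.1 hxy))
    · intro i x hx y hy hxy
      induction y using Fin.cases with
      | zero => exact absurd hxy (Fin.not_lt_zero x)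
      | succ y =>
        induction x using Fin.cases with
        | zero => exact Fin.zero_le _
        | succ x =>
          exact Fin.succ_le_succ_iff.2 (h.weak i x (mem_restrictSucc.2 hx) y
            (mem_restrictSucc.2 hy) (Fin.succ_lt_succ_iff.1 hxy))

/-- The basis element with a new first block `{0}`. -/
def consCell (n : ℕ) (O : Fin u → Finset (Fin (t + 1))) (E : Fin v → Finset (Fin (t + 1))) (m : ℕ)
    (c : DeltaCell n (restrictSucc O) (restrictSucc E) m) : DeltaCell (n + 1) O E (m + 1) :=
  ⟨consZero c.1, (isBasic_consZero_iff c.1).2 c.2⟩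

lemma consCell_injective (m : ℕ) : Function.Injective (consCell n O E m) :=
  fun _ _ h => Subtype.ext (consZero_injective (congrArg Subtype.val h))

lemma exists_consCell_eq {m : ℕ} (c : DeltaCell (n + 1) O E (m + 1))
    (hc : c ∉ noncritical (n + 1) O E (m + 1)) : ∃ c', consCell n O E m c' = c := by
  obtain ⟨h1, h0⟩ : c.1.size (c.1.pos 0) = 1 ∧ (c.1.pos 0 : ℕ) = 0 := by
    simpa [noncritical] using hc
  have h0' : c.1.pos 0 = 0 := Fin.ext h0
  have hne : ∀ x : Fin t, c.1.pos x.succ ≠ 0 := fun x =>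
    h0' ▸ pos_ne_of_size_eq_one c.2 h1 (Fin.succ_ne_zero x)
  let q : BlockPair t m := ⟨fun j => c.1.size j.succ, fun x => (c.1.pos x.succ).pred (hne x)⟩
  have hq : consZero q = c.1 := by
    ext k
    · induction k using Fin.cases with
      | zero => rw [← h0', h1, h0']; rfl
      | succ k => rfl
    · induction k using Fin.cases with
      | zero => exact h0.symm
      | succ k => simp [consZero, q]
  exact ⟨⟨q, (isBasic_consZero_iff q).1 (hq ▸ c.2)⟩, Subtype.ext hq⟩

lemma consCell_not_mem_noncritical {m : ℕ} (c : DeltaCell n (restrictSucc O) (restrictSucc E) m) :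
    consCell n O E m c ∉ noncritical (n + 1) O E (m + 1) :=
  fun h => h rfl rfl

lemma face_succ_consZero {m : ℕ} (k : Fin (m + 1)) (q : BlockPair t (m + 1)) :
    face k.succ (consZero q) = (face k q).map consZero := by
  induction k using Fin.lastCases with
  | cast k =>
    rw [Fin.succ_castSucc, face_castSucc, face_castSucc, Option.map_some]
    congr 1
    ext x
    · induction x using Fin.cases with
      | zero => rfl
      | succ x => simp [BlockPair.merge, consZero]
    · simp only [BlockPair.merge, val_predAbove]
      induction x using Fin.cases with
      | zero => simp [consZero]
      | succ x =>
        simp only [consZero, Fin.cons_succ, Fin.val_succ, val_predAbove]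
        split_ifs <;> omega
  | last =>
    have hiff : (∀ x, (consZero q).pos x ≠ Fin.last (m + 1)) ↔ ∀ x, q.pos x ≠ Fin.last m := by
      rw [Fin.forall_fin_succ]
      simp [consZero, Fin.ext_iff]
    rw [Fin.succ_last, face_last, face_last]
    by_cases h : ∀ x, q.pos x ≠ Fin.last m
    · rw [dif_pos h, dif_pos (hiff.2 h), Option.map_some]
      congr 1
      ext x
      · induction x using Fin.cases <;> rfl
      · induction x using Fin.cases <;> rfl
    · rw [dif_neg h, dif_neg (hiff.not.2 h), Option.map_none]

/-- The projection onto the critical cells; it is surjective and lowers the degree by one. -/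
noncomputable def critProj (n : ℕ) (O : Fin u → Finset (Fin (t + 1)))
    (E : Fin v → Finset (Fin (t + 1))) (m : ℕ) :
    (DeltaCell (n + 1) O E (m + 1) →₀ ℤ) →ₗ[ℤ]
      (DeltaCell n (restrictSucc O) (restrictSucc E) m →₀ ℤ) :=
  Finsupp.lcomapDomain (consCell n O E m) (consCell_injective m)

lemma critProj_apply {m : ℕ} (z : DeltaCell (n + 1) O E (m + 1) →₀ ℤ)
    (c : DeltaCell n (restrictSucc O) (restrictSucc E) m) :
    critProj n O E m z c = z (consCell n O E m c) := rfl

lemma critProj_surjective (m : ℕ) : Function.Surjective (critProj n O E m) :=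
  (Finsupp.leftInverse_lcomapDomain_mapDomain _ (consCell_injective m)).surjective

lemma mem_noncritical_of_critProj_eq_zero {m : ℕ} {z : DeltaCell (n + 1) O E (m + 1) →₀ ℤ}
    (hz : critProj n O E m z = 0) : ∀ x ∈ z.support, x ∈ noncritical (n + 1) O E (m + 1) := by
  intro x hx
  by_contra hne
  obtain ⟨c, rfl⟩ := exists_consCell_eq x hne
  exact Finsupp.mem_support_iff.1 hx (DFunLike.congr_fun hz c)

lemma critProj_eq_zero {m : ℕ} {z : DeltaCell (n + 1) O E (m + 1) →₀ ℤ}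
    (hz : ∀ x ∈ z.support, x ∈ noncritical (n + 1) O E (m + 1)) : critProj n O E m z = 0 := by
  ext c
  by_contra hne
  exact consCell_not_mem_noncritical c (hz _ (Finsupp.mem_support_iff.2 hne))

/-- The sign comes from the shift of the positions of the merged blocks by one. -/
lemma critProj_bdryMap (m : ℕ) (z : DeltaCell (n + 1) O E (m + 2) →₀ ℤ) :
    critProj n O E m (bdryMap (n + 1) O E (m + 1) z) =
      -bdryMap n (restrictSucc O) (restrictSucc E) m (critProj n O E (m + 1) z) := by
  classical
  suffices h : critProj n O E m ∘ₗ bdryMap (n + 1) O E (m + 1) =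
      -(bdryMap n (restrictSucc O) (restrictSucc E) m ∘ₗ critProj n O E (m + 1)) from
    LinearMap.congr_fun h z
  apply Finsupp.lhom_ext'
  intro c
  ext1
  simp only [LinearMap.comp_apply, LinearMap.neg_apply, Finsupp.lsingle_apply]
  by_cases hc : c ∈ noncritical (n + 1) O E (m + 2)
  · rw [critProj_eq_zero (z := Finsupp.single c 1), map_zero, neg_zero]
    · ext y
      by_contra hne
      exact consCell_not_mem_noncritical y (noncritical_of_bdryMap_ne_zero hc hne)
    · intro x hx
      rwa [Finset.mem_singleton.1 (Finsupp.support_single_subset hx)]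
  · obtain ⟨c, rfl⟩ := exists_consCell_eq c hc
    have hs : critProj n O E (m + 1) (Finsupp.single (consCell n O E (m + 1) c) 1) =
        Finsupp.single c 1 := by
      ext y
      simp only [critProj_apply, Finsupp.single_apply, (consCell_injective (m + 1)).eq_iff]
    rw [hs]
    ext y
    rw [critProj_apply, Finsupp.neg_apply, bdryMap_single_apply, bdryMap_single_apply,
      Fin.sum_univ_succ, if_neg, zero_add, ← Finset.sum_neg_distrib]
    · refine Finset.sum_congr rfl fun i _ => ?_
      have hiff : face i.succ (consCell n O E (m + 1) c).1 = some (consCell n O E m y).1 ↔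
          face i c.1 = some y.1 := by
        change face i.succ (consZero c.1) = some (consZero y.1) ↔ _
        rw [face_succ_consZero, ← Option.map_some,
          (Option.map_injective consZero_injective).eq_iff]
      simp only [hiff, Fin.val_succ, pow_succ]
      split_ifs <;> ring
    · -- merging the first two blocks yields a first block of size at least `2`
      intro h
      have h1 := face_size h 0
      have h2 := c.2.size_pos 0
      change 1 = if ((0 : Fin (m + 1)) : ℕ) < ((0 : Fin (m + 2)) : ℕ) then _
        else if ((0 : Fin (m + 1)) : ℕ) = ((0 : Fin (m + 2)) : ℕ) then 1 + c.1.size 0 else _ at h1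
      rw [if_neg (by simp), if_pos (by simp)] at h1
      omega

lemma isFreeCycle_critProj {m : ℕ} {z : DeltaCell (n + 1) O E (m + 1) →₀ ℤ}
    (hz : IsFreeCycle (bdryMap (n + 1) O E) z) :
    IsFreeCycle (bdryMap n (restrictSucc O) (restrictSucc E)) (critProj n O E m z) := by
  cases m with
  | zero => trivial
  | succ m =>
    have hz' : bdryMap (n + 1) O E (m + 1) z = 0 := hz
    change bdryMap n (restrictSucc O) (restrictSucc E) m (critProj n O E (m + 1) z) = 0
    rw [← neg_eq_zero, ← critProj_bdryMap, hz', map_zero]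

/-- With at least one element there is no cell without blocks. -/
lemma isEmpty_zero : IsEmpty (DeltaCell n O E 0) :=
  ⟨fun c => (c.1.pos 0).elim0⟩

/-- Exactness passes from the quotient of critical cells to the whole complex. -/
lemma exists_bdry_eq_succ (hE : ∀ i, 0 ∉ E i) {m : ℕ}
    (h : ∀ z : DeltaCell n (restrictSucc O) (restrictSucc E) m →₀ ℤ,
      IsFreeCycle (bdryMap n (restrictSucc O) (restrictSucc E)) z →
        ∃ w, bdryMap n (restrictSucc O) (restrictSucc E) m w = z)
    (z : DeltaCell (n + 1) O E (m + 1) →₀ ℤ) (hz : IsFreeCycle (bdryMap (n + 1) O E) z) :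
    ∃ w, bdryMap (n + 1) O E (m + 1) w = z := by
  obtain ⟨w, hw⟩ := h _ (isFreeCycle_critProj hz)
  obtain ⟨x, rfl⟩ := critProj_surjective (m + 1) w
  have hz' : bdryMap (n + 1) O E m z = 0 := hz
  obtain ⟨y, hy, -⟩ := exists_bdry_eq_of_noncritical hE (z + bdryMap (n + 1) O E (m + 1) x)
    (by
      change bdryMap (n + 1) O E m (z + bdryMap (n + 1) O E (m + 1) x) = 0
      rw [map_add, hz', bdryMap_bdryMap, add_zero])
    (mem_noncritical_of_critProj_eq_zero (by
      rw [map_add, critProj_bdryMap, hw, add_neg_cancel]))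
  exact ⟨y - x, by rw [map_sub, hy, add_sub_cancel_right]⟩

/-- A generator of the top cycles of the quotient of critical cells lifts to one of the whole
complex. -/
lemma exists_generator_succ (hE : ∀ i, 0 ∉ E i) {m : ℕ} (h0 : bdryMap (n + 1) O E (m + 1) = 0)
    (h : ∃ g : DeltaCell n (restrictSucc O) (restrictSucc E) m →₀ ℤ,
      IsFreeCycle (bdryMap n (restrictSucc O) (restrictSucc E)) g ∧
      ∀ z, IsFreeCycle (bdryMap n (restrictSucc O) (restrictSucc E)) z → ∃! k : ℤ, k • g = z) :
    ∃ g : DeltaCell (n + 1) O E (m + 1) →₀ ℤ, IsFreeCycle (bdryMap (n + 1) O E) g ∧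
      ∀ z : DeltaCell (n + 1) O E (m + 1) →₀ ℤ, IsFreeCycle (bdryMap (n + 1) O E) z →
        ∃! k : ℤ, k • g = z := by
  obtain ⟨g₀, hg₀, huniq⟩ := h
  obtain ⟨x, hx⟩ := critProj_surjective m g₀
  -- the lift `x` is corrected to a cycle, its boundary being a noncritical cycle
  obtain ⟨y, hyx, hy⟩ : ∃ y, bdryMap (n + 1) O E m y = bdryMap (n + 1) O E m x ∧
      critProj n O E m y = 0 := by
    cases m with
    | zero =>
      have : IsEmpty (DeltaCell (n + 1) O E 0) := isEmpty_zero
      exact ⟨0, Subsingleton.elim _ _, map_zero _⟩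
    | succ m =>
      have hg₀' : bdryMap n (restrictSucc O) (restrictSucc E) m g₀ = 0 := hg₀
      obtain ⟨y, hyx, hy⟩ := exists_bdry_eq_of_noncritical hE (bdryMap (n + 1) O E (m + 1) x)
        (bdryMap_bdryMap m x) (mem_noncritical_of_critProj_eq_zero (by
          rw [critProj_bdryMap, hx, hg₀', neg_zero]))
      exact ⟨y, hyx, critProj_eq_zero hy⟩
  have hq : critProj n O E m (x - y) = g₀ := by rw [map_sub, hx, hy, sub_zero]
  have hg : bdryMap (n + 1) O E m (x - y) = 0 := by rw [map_sub, hyx, sub_self]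
  refine ⟨x - y, hg, fun z hz => ?_⟩
  obtain ⟨k, hk, hk'⟩ := huniq _ (isFreeCycle_critProj hz)
  have hz' : bdryMap (n + 1) O E m z = 0 := hz
  refine ⟨k, ?_, fun l hl => hk' l ?_⟩
  · have hc : bdryMap (n + 1) O E m (k • (x - y) - z) = 0 := by
      rw [map_sub, map_smul, hg, smul_zero, hz', sub_zero]
    obtain ⟨w, hw, -⟩ := exists_bdry_eq_of_noncritical hE (k • (x - y) - z) hc
      (mem_noncritical_of_critProj_eq_zero (by
        rw [map_sub, map_smul, hq]
        exact sub_eq_zero.2 hk))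
    rw [h0] at hw
    exact sub_eq_zero.1 hw.symm
  · change l • g₀ = critProj n O E m z
    rw [← hl, map_smul, hq]

end Critical

/-! ### Induction on the number of elements -/

lemma isEmpty_of_lt {t u v n m : ℕ} {O : Fin u → Finset (Fin t)} {E : Fin v → Finset (Fin t)}
    (h : n < m ∨ n < t) : IsEmpty (DeltaCell n O E m) := by
  refine ⟨fun c => ?_⟩
  have h1 := c.2.sum_le
  have h2 := c.2.le_sum
  have h3 : m ≤ ∑ j, c.1.size j := by
    calc m = ∑ _j : Fin m, 1 := by simp
      _ ≤ _ := Finset.sum_le_sum fun j _ => c.2.size_pos j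
  omega

lemma bdryMap_top_eq_zero {t u v n : ℕ} (O : Fin u → Finset (Fin t)) (E : Fin v → Finset (Fin t)) :
    bdryMap n O E n = 0 := by
  have : IsEmpty (DeltaCell n O E (n + 1)) := isEmpty_of_lt (Or.inl (Nat.lt_succ_self n))
  exact Subsingleton.elim _ _

lemma exists_bdry_eq_of_isEmpty {t u v n m : ℕ} {O : Fin u → Finset (Fin t)}
    {E : Fin v → Finset (Fin t)} (h : IsEmpty (DeltaCell n O E m)) (z : DeltaCell n O E m →₀ ℤ) :
    ∃ w, bdryMap n O E m w = z :=
  ⟨0, Subsingleton.elim _ _⟩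

/-- Acyclicity: the induction stops as soon as `0` lies in some `E i`, and otherwise lowers `n` and
`t` together, so that `h` persists and leaves only `n > 0` for `t = 0`. -/
theorem exists_bdry_eq {t u v : ℕ} (n : ℕ) (O : Fin u → Finset (Fin t))
    (E : Fin v → Finset (Fin t)) (hOE : ∀ i j, Disjoint (O i) (E j)) (hE2 : ∀ j, 2 ≤ (E j).card)
    (h : ¬(t = n ∧ v = 0)) (m : ℕ) (z : DeltaCell n O E m →₀ ℤ)
    (hz : IsFreeCycle (bdryMap n O E) z) : ∃ w, bdryMap n O E m w = z := by
  induction t generalizing n m with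
  | zero =>
    have hv : v = 0 := by
      by_contra hv
      have := hE2 ⟨0, Nat.pos_of_ne_zero hv⟩
      rw [Finset.eq_empty_of_isEmpty (E _), Finset.card_empty] at this
      omega
    exact exists_bdry_eq_of_zero (by omega) z hz
  | succ t ih =>
    by_cases hE : ∃ i, 0 ∈ E i
    · obtain ⟨i, hi⟩ := hE
      exact exists_bdry_eq_of_mem_weak hi (hE2 i)
        (fun j hj => Finset.disjoint_left.1 (hOE j i) hj hi) z hz
    · rw [not_exists] at hE
      obtain _ | m := m
      · exact exists_bdry_eq_of_isEmpty isEmpty_zero z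
      obtain _ | n := n
      · exact exists_bdry_eq_of_isEmpty (isEmpty_of_lt (Or.inl m.succ_pos)) z
      refine exists_bdry_eq_succ hE (ih n _ _ ?_ ?_ (by omega) m) z hz
      · intro i j
        rw [Finset.disjoint_left]
        intro x hx hy
        exact Finset.disjoint_left.1 (hOE i j) (mem_restrictSucc.1 hx) (mem_restrictSucc.1 hy)
      · intro j
        rw [card_restrictSucc (hE j)]
        exact hE2 j

/-- For `t = n` and `E` empty, the complex is exact outside degree `n - 1`. -/
theorem exists_bdry_eq_of_ne {u n : ℕ} (O : Fin u → Finset (Fin n)) (E : Fin 0 → Finset (Fin n))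
    (m : ℕ) (hm : m ≠ n) (z : DeltaCell n O E m →₀ ℤ) (hz : IsFreeCycle (bdryMap n O E) z) :
    ∃ w, bdryMap n O E m w = z := by
  induction n generalizing m with
  | zero => exact exists_bdry_eq_of_isEmpty (isEmpty_of_lt (by omega)) z
  | succ n ih =>
    obtain _ | m := m
    · exact exists_bdry_eq_of_isEmpty isEmpty_zero z
    · exact exists_bdry_eq_succ (fun i => i.elim0) (ih _ _ m (by omega)) z hz

/-- For `t = n` and `E` empty, the cycles with `n` blocks form an infinite cyclic group. -/
theorem exists_generator {u n : ℕ} (O : Fin u → Finset (Fin n)) (E : Fin 0 → Finset (Fin n)) :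
    ∃ g : DeltaCell n O E n →₀ ℤ, IsFreeCycle (bdryMap n O E) g ∧
      ∀ z : DeltaCell n O E n →₀ ℤ, IsFreeCycle (bdryMap n O E) z → ∃! k : ℤ, k • g = z := by
  induction n with
  | zero =>
    let c : DeltaCell 0 O E 0 :=
      ⟨⟨Fin.elim0, Fin.elim0⟩, isBasic_of_zero (fun j => j.elim0) (by simp)⟩
    have hc : ∀ c', c' = c := by
      intro c'
      ext k <;> exact k.elim0
    refine ⟨Finsupp.single c 1, trivial, fun z _ => ⟨z c, ?_, fun k hk => ?_⟩⟩
    · ext c'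
      rw [hc c']
      simp
    · rw [← hk]
      simp
  | succ n ih =>
    exact exists_generator_succ (fun i => i.elim0) (bdryMap_top_eq_zero O E) (ih _ _)

end DeltaCell

theorem mainTheorem3 (n t u v : ℕ)
    (O : Fin u → Finset (Fin t)) (E : Fin v → Finset (Fin t))
    (hO : ∀ i j, i ≠ j → Disjoint (O i) (O j))
    (hE : ∀ i j, i ≠ j → Disjoint (E i) (E j))
    (hOE : ∀ i j, Disjoint (O i) (E j))
    (hE2 : ∀ j, 2 ≤ (E j).card) :
    (¬(t = n ∧ v = 0) → (deltaComplex n O E).Acyclic) ∧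
    ((t = n ∧ v = 0) →
      Nonempty ((deltaComplex n O E).homology ((n : ℤ) - 1) ≅ ModuleCat.of ℤ ℤ) ∧
      ∀ i : ℤ, i ≠ (n : ℤ) - 1 →
        CategoryTheory.Limits.IsZero ((deltaComplex n O E).homology i)) := by
  constructor
  · intro h i
    exact deltaComplex_exactAt i fun m _ => DeltaCell.exists_bdry_eq n O E hOE hE2 h m
  · rintro ⟨rfl, rfl⟩
    obtain ⟨g, hg, huniq⟩ := DeltaCell.exists_generator O E
    refine ⟨deltaComplex_homology_iso t (DeltaCell.bdryMap_top_eq_zero O E) g hg huniq, ?_⟩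
    intro i hi
    rw [← HomologicalComplex.exactAt_iff_isZero_homology]
    exact deltaComplex_exactAt i fun m hm =>
      DeltaCell.exists_bdry_eq_of_ne O E m (by rintro rfl; exact hi hm.symm)
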